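/- Let $C$ be a Riemann surface (for instance compact of genus $g>1$) with canonical bundle $K_C$, and fix a square root $K_C^{1/2}$, given by holomorphic transition functions $s_{\alpha\beta}$ over a holomorphic atlas $(U_\alpha,z_\alpha)$ with $s_{\alpha\beta}^2=dz_\beta/dz_\alpha$ and $s_{\alpha\beta}s_{\beta\gamma}=s_{\alpha\gamma}$. Let $n\ge 1$, let $E=J^{n-1}\big(K_C^{-\frac{n-1}{2}}\big)$ be the holomorphic rank $n$ bundle of $(n-1)$-jets of sections of $K_C^{-\frac{n-1}{2}}$, trivialized over $U_\alpha$ by $(f,f',\dots,f^{(n-1)})$ with derivatives with respect to $z_\alpha$, and let $$\{0\}=F^0\subset F^1\subset\dots\subset F^n=E,\qquad F^r=\ker\big(J^{n-1}\to J^{n-1-r}\big),$$ so that $F^r$ consists of the jets whose derivatives of order $<n-r$ vanish. Let $\widetilde E=\bigoplus_{r=0}^{n-1}K_C^{-\frac{n-1}{2}+r}$, trivialized over $U_\alpha$ by the same transition functions $s_{\alpha\beta}$. Let $X=Fl(E)$ be the complex manifold of pairs $(p,W^\bullet)$ with $p\in C$ and $W^\bullet$ a complete flag in $E_p$, and let $X_0\subset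 X$ be the open subset of those $(p,W^\bullet)$ with $\dim(W^j\cap F^{n+i-j}_p)=i$ for all $0\le i\le j\le n$. Let $\pi:X_0\to C$ be the projection. (1) For $0\le k<n$ the leading coefficient (the $k$-th derivative) induces a holomorphic isomorphism $F^{n-k}/F^{n-k-1}\cong K_C^{-\frac{n-1}{2}+k}$; thus $\mathrm{Gr}\,F^\bullet\cong\widetilde E$. (2) There is an isomorphism of holomorphic vector bundles $\Phi:\pi^*E|_{X_0}\xrightarrow{\ \sim\ }\pi^*\widetilde E|_{X_0}$; in particular $\pi^*E|_{X_0}$ is holomorphically a direct sum of line bundles. Moreover $\Phi$ can be chosen such that - $\Phi$ is adapted to the tautological flag: at $x=(p,W^\bullet)\in X_0$ it carries $W^j$ onto the sum of the first $j$ summands of $\widetilde E_p$, for all $j$; - $\Phi$ carries $F^{n-k}_p$ into $\bigoplus_{r\ge k}K_C^{-\frac{n-1}{2}+r}$ and induces on $F^{n-k}/F^{n-k-1}$ the isomorphism of (1), for all $k$; - at $x=(p,W^\bullet)\in X_0$ with $p\in U_\alpha$, the matrix of $\Phi^{-1}$ in the trivializations of $\widetilde E$ and $E$ over $U_\alpha$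 is a lower unipotent matrix $\mathbf N_{-,\alpha}(x)$ whose first $j$ columns span $W^j$, for all $j$. -/

import Mathlib

set_option linter.unusedSectionVars false

open Set Bundle Topology Matrix
open scoped Manifold ContDiff

noncomputable section

/-- A complete flag `W 0 ⊂ W 1 ⊂ ⋯ ⊂ W n` in a complex vector space, with `dim (W j) = j`. -/
@[ext] structure CompleteFlag (n : ℕ) (V : Type*) [AddCommMonoid V] [Module ℂ V] where
  space : Fin (n + 1) → Submodule ℂ V
  mono : Monotone space
  finrank_space : ∀ j, Module.finrank ℂ (space j) = (j : ℕ)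

/-- The span of the first `j` standard basis vectors of `ℂⁿ`. -/
def stdSub (n j : ℕ) : Submodule ℂ (Fin n → ℂ) where
  carrier := {v | ∀ r : Fin n, j ≤ (r : ℕ) → v r = 0}
  add_mem' := fun {a b} ha hb r hr => by simp [ha r hr, hb r hr]
  zero_mem' := fun _ _ => rfl
  smul_mem' := fun c a ha r hr => by simp [ha r hr]

/-- The span of the last `n - j` standard basis vectors of `ℂⁿ`. -/
def oppSub (n j : ℕ) : Submodule ℂ (Fin n → ℂ) where
  carrier := {v | ∀ r : Fin n, (r : ℕ) < j → v r = 0}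
  add_mem' := fun {a b} ha hb r hr => by simp [ha r hr, hb r hr]
  zero_mem' := fun _ _ => rfl
  smul_mem' := fun c a ha r hr => by simp [ha r hr]

theorem mem_stdSub {n j : ℕ} {v : Fin n → ℂ} :
    v ∈ stdSub n j ↔ ∀ r : Fin n, j ≤ (r : ℕ) → v r = 0 := Iff.rfl

theorem mem_oppSub {n j : ℕ} {v : Fin n → ℂ} :
    v ∈ oppSub n j ↔ ∀ r : Fin n, (r : ℕ) < j → v r = 0 := Iff.rfl

theorem stdSub_mono (n : ℕ) : Monotone (stdSub n) :=
  fun _ _ h _ hv r hr => hv r (h.trans hr)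

/-- Vectors supported on the coordinates satisfying `p`. -/
def supportedEquiv {n : ℕ} (p : Fin n → Prop) [DecidablePred p] (S : Submodule ℂ (Fin n → ℂ))
    (hS : ∀ v, v ∈ S ↔ ∀ r, ¬ p r → v r = 0) : S ≃ₗ[ℂ] ({r // p r} → ℂ) where
  toFun v r := v.1 r
  map_add' _ _ := rfl
  map_smul' _ _ := rfl
  invFun w := ⟨fun r => if h : p r then w ⟨r, h⟩ else 0, by rw [hS]; intro r hr; simp [hr]⟩
  left_inv v := by
    ext r
    by_cases h : p r
    · simp [h]
    · simp [h, (hS v.1).1 v.2 r h]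
  right_inv w := by ext r; simp [r.2]

theorem card_filter_val_lt (n j : ℕ) :
    (Finset.univ.filter fun r : Fin n => (r : ℕ) < j).card = min n j := by
  have : (Finset.univ.filter fun r : Fin n => (r : ℕ) < j).map Fin.valEmbedding =
      Finset.range (min n j) := by
    ext k
    simp only [Finset.mem_map, Finset.mem_filter, Finset.mem_univ, true_and, Fin.valEmbedding_apply,
      Finset.mem_range, lt_min_iff]
    exact ⟨fun ⟨r, hr, e⟩ => e ▸ ⟨r.2, hr⟩, fun h => ⟨⟨k, h.1⟩, h.2, rfl⟩⟩
  rw [← Finset.card_map Fin.valEmbedding, this, Finset.card_range]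

theorem finrank_stdSub {n j : ℕ} (hj : j ≤ n) : Module.finrank ℂ (stdSub n j) = j := by
  rw [(supportedEquiv (fun r : Fin n => (r : ℕ) < j) (stdSub n j)
    (fun v => by simp [mem_stdSub])).finrank_eq, Module.finrank_fintype_fun_eq_card,
    Fintype.card_subtype, card_filter_val_lt, min_eq_right hj]

theorem finrank_oppSub {n j : ℕ} (hj : j ≤ n) : Module.finrank ℂ (oppSub n j) = n - j := by
  rw [(supportedEquiv (fun r : Fin n => ¬ (r : ℕ) < j) (oppSub n j)
    (fun v => by simp [mem_oppSub])).finrank_eq, Module.finrank_fintype_fun_eq_card,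
    Fintype.card_subtype, Finset.filter_not, Finset.card_sdiff]
  simp [card_filter_val_lt, hj]

/-- The standard flag `⟨e₁⟩ ⊂ ⟨e₁, e₂⟩ ⊂ ⋯` of `ℂⁿ`. -/
def stdFlag (n : ℕ) : CompleteFlag n (Fin n → ℂ) where
  space j := stdSub n j
  mono _ _ h := stdSub_mono n h
  finrank_space j := finrank_stdSub (Nat.lt_succ_iff.1 j.2)

/-- The image of a flag under a linear isomorphism. -/
def CompleteFlag.map {n : ℕ} {V V' : Type*} [AddCommMonoid V] [Module ℂ V] [AddCommMonoid V']
    [Module ℂ V'] (W : CompleteFlag n V) (φ : V ≃ₗ[ℂ] V') : CompleteFlag n V' where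
  space j := (W.space j).map φ.toLinearMap
  mono _ _ h := Submodule.map_mono (W.mono h)
  finrank_space j := by rw [← W.finrank_space j]; exact LinearEquiv.finrank_map_eq φ _

/-- The span of the first `j` columns of a matrix. -/
def colSpan {n : ℕ} (M : Matrix (Fin n) (Fin n) ℂ) (j : ℕ) : Submodule ℂ (Fin n → ℂ) :=
  (stdSub n j).map (Matrix.toLin' M)

theorem colSpan_mul {n : ℕ} (A B : Matrix (Fin n) (Fin n) ℂ) (j : ℕ) :
    colSpan (A * B) j = (colSpan B j).map (Matrix.toLin' A) := by
  rw [colSpan, colSpan, Matrix.toLin'_mul, Submodule.map_comp]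

/-- The positions strictly below the diagonal of an `n × n` matrix. -/
abbrev LowerIdx (n : ℕ) : Type := {p : Fin n × Fin n // p.2 < p.1}

/-- The lower unipotent matrix with prescribed entries below the diagonal. -/
def lowerUni {n : ℕ} (u : LowerIdx n → ℂ) : Matrix (Fin n) (Fin n) ℂ :=
  fun r c => if r = c then 1 else if h : c < r then u ⟨(r, c), h⟩ else 0

theorem lowerUni_diag {n : ℕ} (u : LowerIdx n → ℂ) (r : Fin n) : lowerUni u r r = 1 := by
  simp [lowerUni]

theorem lowerUni_upper {n : ℕ} (u : LowerIdx n → ℂ) {r c : Fin n} (h : r < c) :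
    lowerUni u r c = 0 := by
  simp [lowerUni, h.ne, h.not_gt]

theorem lowerUni_lower {n : ℕ} (u : LowerIdx n → ℂ) (p : LowerIdx n) :
    lowerUni u p.1.1 p.1.2 = u p := by
  simp [lowerUni, p.2.ne', p.2]

theorem det_lowerUni {n : ℕ} (u : LowerIdx n → ℂ) : (lowerUni u).det = 1 := by
  rw [Matrix.det_of_isLowerTriangular _ (fun r c h => lowerUni_upper u h)]
  simp [lowerUni_diag]

/-- The matrix whose first `j` columns are those of `M` and whose other columns are standard
basis vectors. -/
def mix {n : ℕ} (M : Matrix (Fin n) (Fin n) ℂ) (j : ℕ) : Matrix (Fin n) (Fin n) ℂ :=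
  fun r c => if (c : ℕ) < j then M r c else if r = c then 1 else 0

/-- All leading principal minors of `M` are nonzero. -/
def IsBig {n : ℕ} (M : Matrix (Fin n) (Fin n) ℂ) : Prop := ∀ j : Fin (n + 1), (mix M j).det ≠ 0

theorem mix_self {n : ℕ} (M : Matrix (Fin n) (Fin n) ℂ) : mix M n = M := by
  ext r c; simp [mix]

theorem IsBig.det_ne_zero {n : ℕ} {M : Matrix (Fin n) (Fin n) ℂ} (h : IsBig M) : M.det ≠ 0 := by
  have := h (Fin.last n)
  rwa [Fin.val_last, mix_self] at this

theorem mix_mulVec {n : ℕ} (M : Matrix (Fin n) (Fin n) ℂ) (j : ℕ) (x : Fin n → ℂ) :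
    mix M j *ᵥ x = M *ᵥ (fun c : Fin n => if (c : ℕ) < j then x c else 0) +
      (fun c : Fin n => if (c : ℕ) < j then 0 else x c) := by
  ext r
  simp only [Matrix.mulVec, dotProduct, Pi.add_apply]
  have h2 : (if (r : ℕ) < j then 0 else x r) =
      ∑ c : Fin n, if r = c then (if (c : ℕ) < j then 0 else x c) else 0 := by
    simp
  rw [h2, ← Finset.sum_add_distrib]
  refine Finset.sum_congr rfl fun c _ => ?_
  by_cases hc : (c : ℕ) < j
  · simp [mix, hc]
  · by_cases hr : r = c <;> simp [mix, hc, hr]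

theorem mem_colSpan {n : ℕ} {M : Matrix (Fin n) (Fin n) ℂ} {j : ℕ} {v : Fin n → ℂ} :
    v ∈ colSpan M j ↔ ∃ x ∈ stdSub n j, M *ᵥ x = v := by
  simp [colSpan, Submodule.mem_map]

theorem det_mix_ne_zero_iff {n : ℕ} {M : Matrix (Fin n) (Fin n) ℂ} (hM : M.det ≠ 0) (j : ℕ) :
    (mix M j).det ≠ 0 ↔ colSpan M j ⊓ oppSub n j = ⊥ := by
  have hinj := Matrix.mulVec_injective_iff_isUnit.2
    ((Matrix.isUnit_iff_isUnit_det M).2 (isUnit_iff_ne_zero.2 hM))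
  rw [← isUnit_iff_ne_zero, ← Matrix.isUnit_iff_isUnit_det, ← Matrix.mulVec_injective_iff_isUnit]
  constructor
  · intro h
    rw [eq_bot_iff]
    rintro v ⟨hv, hv'⟩
    obtain ⟨x, hx, rfl⟩ := mem_colSpan.1 hv
    have key : mix M j *ᵥ (fun c : Fin n => if (c : ℕ) < j then x c else -(M *ᵥ x) c) = mix M j *ᵥ 0 := by
      rw [mix_mulVec, Matrix.mulVec_zero]
      have e1 : (fun c : Fin n => if (c : ℕ) < j then
          (if (c : ℕ) < j then x c else -(M *ᵥ x) c) else 0) = x := by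
        ext c; by_cases hc : (c : ℕ) < j
        · simp [hc]
        · simp [hc, hx c (not_lt.1 hc)]
      rw [e1]
      ext c
      by_cases hc : (c : ℕ) < j
      · have := hv' c hc
        simp_all
      · simp [hc]
    have h0 := h key
    have : x = 0 := by
      ext c
      by_cases hc : (c : ℕ) < j
      · simpa [hc] using congrFun h0 c
      · exact hx c (not_lt.1 hc)
    simp [this]
  · intro h
    rw [← Matrix.coe_mulVecLin, ← LinearMap.ker_eq_bot, eq_bot_iff]
    intro x hx
    rw [LinearMap.mem_ker, Matrix.mulVecLin_apply, mix_mulVec] at hx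
    set y : Fin n → ℂ := fun c => if (c : ℕ) < j then x c else 0 with hy
    have hmem : M *ᵥ y ∈ colSpan M j ⊓ oppSub n j := by
      refine ⟨mem_colSpan.2 ⟨y, fun r hr => by simp [hy, not_lt.2 hr], rfl⟩, fun r hr => ?_⟩
      have := congrFun hx r
      simpa [hr] using this
    rw [h, Submodule.mem_bot] at hmem
    have hy0 : y = 0 := hinj (by simpa using hmem)
    rw [hmem, zero_add] at hx
    rw [Submodule.mem_bot]
    ext c
    by_cases hc : (c : ℕ) < j
    · simpa [hy, hc] using congrFun hy0 c
    · simpa [hc] using congrFun hx c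

theorem isBig_lowerUni {n : ℕ} (u : LowerIdx n → ℂ) : IsBig (lowerUni u) := by
  intro j
  rw [Matrix.det_of_isLowerTriangular]
  · refine Finset.prod_ne_zero_iff.2 fun r _ => ?_
    by_cases hr : (r : ℕ) < j <;> simp [mix, hr, lowerUni_diag]
  · intro r c h
    have h : r < c := h
    by_cases hr : (c : ℕ) < j <;> simp [mix, hr, lowerUni_upper u h, h.ne]

theorem lowerUni_inj {n : ℕ} {u u' : LowerIdx n → ℂ}
    (h : ∀ j : Fin (n + 1), colSpan (lowerUni u) j = colSpan (lowerUni u') j) : u = u' := by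
  ext ⟨⟨r, c⟩, hp⟩
  have hp : c < r := hp
  have hcol : ∀ w : LowerIdx n → ℂ, (lowerUni w) *ᵥ Pi.single c 1 ∈
      colSpan (lowerUni w) (c + 1 : ℕ) := fun w =>
    mem_colSpan.2 ⟨_, fun s hs => by
      have : s ≠ c := fun e => by subst e; omega
      simp [this], rfl⟩
  have hbot := (det_mix_ne_zero_iff (by simp [det_lowerUni]) _).1 (isBig_lowerUni u c.succ)
  have hmem : (lowerUni u) *ᵥ Pi.single c 1 - (lowerUni u') *ᵥ Pi.single c 1 ∈
      colSpan (lowerUni u) c.succ ⊓ oppSub n c.succ := by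
    refine ⟨Submodule.sub_mem _ (hcol u) (by rw [h]; exact hcol u'), fun s hs => ?_⟩
    simp only [Matrix.mulVec_single_one, Pi.sub_apply, Matrix.col_apply]
    have hs : s ≤ c := by simp at hs; omega
    rcases hs.eq_or_lt with rfl | hs
    · simp [lowerUni_diag]
    · simp [lowerUni_upper _ hs]
  rw [hbot, Submodule.mem_bot] at hmem
  have := congrFun hmem r
  simp only [Matrix.mulVec_single_one, Pi.sub_apply, Matrix.col_apply, Pi.zero_apply,
    sub_eq_zero] at this
  have e1 := lowerUni_lower u ⟨(r, c), hp⟩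
  have e2 := lowerUni_lower u' ⟨(r, c), hp⟩
  simp only at e1 e2
  rw [← e1, ← e2, this]

theorem finrank_colSpan {n : ℕ} {M : Matrix (Fin n) (Fin n) ℂ} (hM : M.det ≠ 0) {j : ℕ}
    (hj : j ≤ n) : Module.finrank ℂ (colSpan M j) = j := by
  have hinj : Function.Injective (Matrix.toLin' M) := Matrix.mulVec_injective_iff_isUnit.2
    ((Matrix.isUnit_iff_isUnit_det M).2 (isUnit_iff_ne_zero.2 hM))
  rw [colSpan, ← (Submodule.equivMapOfInjective _ hinj (stdSub n j)).finrank_eq, finrank_stdSub hj]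

/-- The entries below the diagonal of the lower unipotent factor in the Gauss factorization of a
matrix. -/
def lowerPart {n : ℕ} (M : Matrix (Fin n) (Fin n) ℂ) : LowerIdx n → ℂ :=
  fun p => -(mix M (p.1.2 + 1))⁻¹ p.1.1 p.1.2

theorem colSpan_lowerPart {n : ℕ} {M : Matrix (Fin n) (Fin n) ℂ} (h : IsBig M)
    (j : Fin (n + 1)) : colSpan (lowerUni (lowerPart M)) j = colSpan M j := by
  refine Submodule.eq_of_le_of_finrank_eq ?_ ?_
  swap
  · rw [finrank_colSpan h.det_ne_zero (Nat.lt_succ_iff.1 j.2),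
      finrank_colSpan (by simp [det_lowerUni]) (Nat.lt_succ_iff.1 j.2)]
  intro v hv
  obtain ⟨x, hx, rfl⟩ := mem_colSpan.1 hv
  have : lowerUni (lowerPart M) *ᵥ x = ∑ c, x c • (lowerUni (lowerPart M)).col c := by
    rw [Matrix.mulVec_eq_sum]
    exact Finset.sum_congr rfl fun c _ => op_smul_eq_smul _ _
  rw [this]
  refine Submodule.sum_mem _ fun c _ => ?_
  by_cases hc : (j : ℕ) ≤ c
  · rw [hx c hc]; simp
  refine Submodule.smul_mem _ _ ?_
  have hc' : (c : ℕ) + 1 ≤ j := by omega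
  set A := mix M (c + 1) with hA
  have hdet : IsUnit A.det := isUnit_iff_ne_zero.2 (h c.succ)
  set y : Fin n → ℂ := A⁻¹ *ᵥ Pi.single c 1 with hy
  have hAy : A *ᵥ y = Pi.single c 1 := by
    rw [hy, Matrix.mulVec_mulVec, Matrix.mul_nonsing_inv _ hdet, Matrix.one_mulVec]
  rw [hA, mix_mulVec] at hAy
  refine mem_colSpan.2 ⟨fun r : Fin n => if (r : ℕ) < c + 1 then y r else 0, fun r hr => ?_, ?_⟩
  · have : ¬ (r : ℕ) < c + 1 := by omega
    simp [this]
  · ext r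
    have := congrFun hAy r
    rw [Pi.add_apply] at this
    rw [Matrix.col_apply]
    rcases lt_trichotomy r c with hr | hr | hr
    · have h1 : (r : ℕ) < c + 1 := by omega
      simpa [h1, lowerUni_upper _ hr, hr.ne] using this
    · subst hr
      simpa [lowerUni_diag] using this
    · have h1 : ¬ (r : ℕ) < c + 1 := by omega
      have e1 := lowerUni_lower (lowerPart M) ⟨(r, c), hr⟩
      simp only at e1
      rw [e1, lowerPart, ← hA]
      have e2 : y r = A⁻¹ r c := by simp [hy]
      rw [← e2]
      simp only [h1, if_false, hr.ne', Pi.single_apply] at this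
      linear_combination this

theorem isBig_of_colSpan_eq {n : ℕ} {M : Matrix (Fin n) (Fin n) ℂ} (hM : M.det ≠ 0)
    {u : LowerIdx n → ℂ} (h : ∀ j : Fin (n + 1), colSpan M j = colSpan (lowerUni u) j) :
    IsBig M := by
  intro j
  rw [det_mix_ne_zero_iff hM, h, ← det_mix_ne_zero_iff (by simp [det_lowerUni])]
  exact isBig_lowerUni u j

theorem contDiffAt_det {n : ℕ} {E : Type*} [NormedAddCommGroup E] [NormedSpace ℂ E]
    {A : E → Matrix (Fin n) (Fin n) ℂ} {x : E}
    (hA : ∀ r c, ContDiffAt ℂ ω (fun y => A y r c) x) : ContDiffAt ℂ ω (fun y => (A y).det) x := by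
  simp only [Matrix.det_apply]
  refine ContDiffAt.sum fun σ _ => ?_
  refine ContDiffAt.const_smul _ (contDiffAt_prod fun i _ => hA _ _)

theorem contDiffAt_inv_entry {n : ℕ} {E : Type*} [NormedAddCommGroup E] [NormedSpace ℂ E]
    {A : E → Matrix (Fin n) (Fin n) ℂ} {x : E}
    (hA : ∀ r c, ContDiffAt ℂ ω (fun y => A y r c) x) (hx : (A x).det ≠ 0) (r c : Fin n) :
    ContDiffAt ℂ ω (fun y => (A y)⁻¹ r c) x := by
  simp only [Matrix.inv_def, Ring.inverse_eq_inv', Matrix.smul_apply, smul_eq_mul,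
    Matrix.adjugate_apply]
  refine ((contDiffAt_det hA).inv hx).mul (contDiffAt_det fun i j => ?_)
  by_cases hi : i = c
  · subst hi; simpa using contDiffAt_const
  · simpa [Matrix.updateRow_apply, hi] using hA i j

theorem contDiffAt_mix {n : ℕ} {E : Type*} [NormedAddCommGroup E] [NormedSpace ℂ E]
    {A : E → Matrix (Fin n) (Fin n) ℂ} {x : E}
    (hA : ∀ r c, ContDiffAt ℂ ω (fun y => A y r c) x) (j : ℕ) (r c : Fin n) :
    ContDiffAt ℂ ω (fun y => mix (A y) j r c) x := by
  unfold mix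
  by_cases hc : (c : ℕ) < j
  · simpa [hc] using hA r c
  · simpa [hc] using contDiffAt_const

theorem contDiffAt_lowerPart {n : ℕ} {E : Type*} [NormedAddCommGroup E] [NormedSpace ℂ E]
    {A : E → Matrix (Fin n) (Fin n) ℂ} {x : E}
    (hA : ∀ r c, ContDiffAt ℂ ω (fun y => A y r c) x) (hx : IsBig (A x)) :
    ContDiffAt ℂ ω (fun y => lowerPart (A y)) x := by
  rw [contDiffAt_pi]
  intro p
  exact (contDiffAt_inv_entry (contDiffAt_mix hA _) (hx p.1.2.succ) _ _).neg

theorem eventually_isBig {n : ℕ} {E : Type*} [NormedAddCommGroup E] [NormedSpace ℂ E]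
    {A : E → Matrix (Fin n) (Fin n) ℂ} {x : E}
    (hA : ∀ r c, ContDiffAt ℂ ω (fun y => A y r c) x) (hx : IsBig (A x)) :
    ∀ᶠ y in 𝓝 x, IsBig (A y) := by
  unfold IsBig
  rw [Filter.eventually_all]
  intro j
  exact (contDiffAt_det (contDiffAt_mix hA _)).continuousAt.eventually_ne (hx j)

theorem contDiffAt_lowerUni {n : ℕ} (a : ℂ × (LowerIdx n → ℂ)) (i j : Fin n) :
    ContDiffAt ℂ ω (fun b : ℂ × (LowerIdx n → ℂ) => lowerUni b.2 i j) a := by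
  unfold lowerUni
  by_cases hij : i = j
  · simpa [hij] using contDiffAt_const
  · by_cases hlt : j < i
    · simp only [hij, hlt, if_false, dite_true]
      fun_prop
    · simpa [hij, hlt] using contDiffAt_const

/-- Every complete flag in `ℂⁿ` is spanned by the columns of an invertible matrix. -/
theorem CompleteFlag.exists_frame {n : ℕ} (W : CompleteFlag n (Fin n → ℂ)) :
    ∃ M : Matrix (Fin n) (Fin n) ℂ, M.det ≠ 0 ∧ ∀ j, W.space j = colSpan M j := by
  have hlt : ∀ k : Fin n, W.space k.castSucc < W.space k.succ := fun k => by
    refine lt_of_le_of_ne (W.mono k.castSucc_lt_succ.le) fun h => ?_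
    have := congrArg (fun S : Submodule ℂ (Fin n → ℂ) => Module.finrank ℂ S) h
    simp [W.finrank_space] at this
  choose v hv hv' using fun k => SetLike.exists_of_lt (hlt k)
  let M : Matrix (Fin n) (Fin n) ℂ := fun r c => v c r
  have hcol : ∀ c, M.col c = v c := fun c => rfl
  have hle : ∀ (c : Fin n) (j : ℕ), (c : ℕ) < j → v c ∈ colSpan M j := fun c j h =>
    mem_colSpan.2 ⟨Pi.single c 1, fun s hs => by
      have : s ≠ c := fun e => by subst e; omega
      simp [this], by simp [hcol]⟩
  have hW : ∀ j : Fin (n + 1), W.space j ≤ colSpan M j := by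
    intro j
    induction j using Fin.induction with
    | zero =>
      have := W.finrank_space 0
      rw [Fin.val_zero, Submodule.finrank_eq_zero] at this
      simp [this]
    | succ k ih =>
      have hsup : W.space k.castSucc ⊔ Submodule.span ℂ {v k} = W.space k.succ := by
        have h1 : W.space k.castSucc ⊔ Submodule.span ℂ {v k} ≤ W.space k.succ :=
          sup_le (hlt k).le (by simpa using hv k)
        refine Submodule.eq_of_le_of_finrank_le h1 ?_
        have h2 : W.space k.castSucc < W.space k.castSucc ⊔ Submodule.span ℂ {v k} := by
          refine lt_of_le_of_ne le_sup_left fun h => hv' k ?_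
          rw [h]
          exact Submodule.mem_sup_right (Submodule.mem_span_singleton_self _)
        have h3 := Submodule.finrank_lt_finrank_of_lt h2
        rw [W.finrank_space] at h3 ⊢
        simp at h3 ⊢
        omega
      rw [← hsup]
      refine sup_le (ih.trans (Submodule.map_mono (stdSub_mono n (by simp)))) ?_
      simpa using hle k (k + 1) (by omega)
  have htop : W.space (Fin.last n) = ⊤ := Submodule.eq_top_of_finrank_eq (by
    rw [W.finrank_space]; simp)
  have hsurj : Function.Surjective M.mulVec := fun w => by
    have : w ∈ colSpan M (Fin.last n) := hW _ (by rw [htop]; trivial)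
    obtain ⟨x, -, hx⟩ := mem_colSpan.1 this
    exact ⟨x, hx⟩
  have hdet : M.det ≠ 0 := by
    rw [← isUnit_iff_ne_zero, ← Matrix.isUnit_iff_isUnit_det]
    exact Matrix.mulVec_surjective_iff_isUnit.1 hsurj
  refine ⟨M, hdet, fun j => Submodule.eq_of_le_of_finrank_eq (hW j) ?_⟩
  rw [W.finrank_space, finrank_colSpan hdet (Nat.lt_succ_iff.1 j.2)]

/-- The relative flag manifold `Fl(E)`: pairs of a point `p` of `C` and a complete flag in `E p`. -/
@[ext] structure FlagBundle {C : Type*} (n : ℕ) (E : C → Type*) [∀ p, AddCommMonoid (E p)]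
    [∀ p, Module ℂ (E p)] where
  base : C
  flag : CompleteFlag n (E base)

namespace FlagBundle

variable {C : Type*} [TopologicalSpace C] [ChartedSpace ℂ C] {n : ℕ} {E : C → Type*}
  [∀ p, AddCommMonoid (E p)] [∀ p, Module ℂ (E p)] [TopologicalSpace (TotalSpace (Fin n → ℂ) E)]
  [∀ p, TopologicalSpace (E p)] [FiberBundle (Fin n → ℂ) E] [VectorBundle ℂ (Fin n → ℂ) E]

/-- A flag in a fibre of `E`, read in a local trivialization of `E`. -/
def trivFlag (e : Trivialization (Fin n → ℂ) (π (Fin n → ℂ) E)) [e.IsLinear ℂ]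
    (x : FlagBundle n E) (j : Fin (n + 1)) : Submodule ℂ (Fin n → ℂ) :=
  (x.flag.space j).map (e.linearMapAt ℂ x.base)

/-- The local trivialization used around a flag. -/
abbrev triv (x : FlagBundle n E) : Trivialization (Fin n → ℂ) (π (Fin n → ℂ) E) :=
  trivializationAt (Fin n → ℂ) E x.base

theorem exists_frame (x : FlagBundle n E) : ∃ M : Matrix (Fin n) (Fin n) ℂ, M.det ≠ 0 ∧
    ∀ j, trivFlag x.triv x j = colSpan M j := by
  obtain ⟨M, hM, h⟩ := (x.flag.map (x.triv.linearEquivAt ℂ x.base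
    (mem_baseSet_trivializationAt _ _ _))).exists_frame
  refine ⟨M, hM, fun j => ?_⟩
  rw [← h, trivFlag, Trivialization.linearMapAt_def_of_mem _ (mem_baseSet_trivializationAt _ _ _)]
  rfl

/-- An invertible matrix whose columns span the flag `x`, in the trivialization around `x`. -/
def frame (x : FlagBundle n E) : Matrix (Fin n) (Fin n) ℂ := x.exists_frame.choose

theorem det_frame (x : FlagBundle n E) : x.frame.det ≠ 0 := x.exists_frame.choose_spec.1

theorem trivFlag_self (x : FlagBundle n E) (j : Fin (n + 1)) :
    trivFlag x.triv x j = colSpan x.frame j := x.exists_frame.choose_spec.2 j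

theorem det_frame_mul (x : FlagBundle n E) (u : LowerIdx n → ℂ) :
    (x.frame * lowerUni u).det ≠ 0 := by
  simp [det_lowerUni, det_frame]

theorem colSpan_cancel {A B B' : Matrix (Fin n) (Fin n) ℂ} (hA : A.det ≠ 0) {j : ℕ}
    (h : colSpan (A * B) j = colSpan (A * B') j) : colSpan B j = colSpan B' j := by
  have := congrArg (Submodule.map (Matrix.toLin' A⁻¹)) h
  rwa [← colSpan_mul, ← colSpan_mul, Matrix.nonsing_inv_mul_cancel_left _ _
    (isUnit_iff_ne_zero.2 hA), Matrix.nonsing_inv_mul_cancel_left _ _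
    (isUnit_iff_ne_zero.2 hA)] at this

/-- The point of `Fl(E)` over `p` whose flag is spanned by the columns of `M` in a
trivialization. -/
def ofFrame (e : Trivialization (Fin n → ℂ) (π (Fin n → ℂ) E)) [e.IsLinear ℂ] {p : C}
    (hp : p ∈ e.baseSet) (M : Matrix (Fin n) (Fin n) ℂ) (hM : M.det ≠ 0) : FlagBundle n E where
  base := p
  flag := (stdFlag n).map ((LinearMap.equivOfDetNeZero (Matrix.toLin' M)
    (by rwa [LinearMap.det_toLin'])).trans (e.linearEquivAt ℂ p hp).symm)

theorem trivFlag_ofFrame (e : Trivialization (Fin n → ℂ) (π (Fin n → ℂ) E)) [e.IsLinear ℂ] {p : C}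
    (hp : p ∈ e.baseSet) (M : Matrix (Fin n) (Fin n) ℂ) (hM : M.det ≠ 0) (j : Fin (n + 1)) :
    trivFlag e (ofFrame e hp M hM) j = colSpan M j := by
  rw [trivFlag]
  simp only [ofFrame, CompleteFlag.map, stdFlag, colSpan]
  rw [Trivialization.linearMapAt_def_of_mem _ hp, ← Submodule.map_comp]
  congr 1
  refine LinearMap.ext fun v => ?_
  change e.linearEquivAt ℂ p hp ((e.linearEquivAt ℂ p hp).symm _) = _
  rw [LinearEquiv.apply_symm_apply]
  rfl

theorem ext_of_trivFlag (e : Trivialization (Fin n → ℂ) (π (Fin n → ℂ) E)) [e.IsLinear ℂ]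
    {x y : FlagBundle n E} (hx : x.base ∈ e.baseSet) (hb : x.base = y.base)
    (h : ∀ j, trivFlag e x j = trivFlag e y j) : x = y := by
  obtain ⟨p, W⟩ := x
  obtain ⟨q, W'⟩ := y
  obtain rfl : p = q := hb
  congr 1
  ext1
  funext j
  have := h j
  simp only [trivFlag, Trivialization.linearMapAt_def_of_mem _ hx] at this
  exact Submodule.map_injective_of_injective (e.linearEquivAt ℂ p hx).injective this

open Classical in
/-- The chart of `Fl(E)` around `x`: a point near `x` has coordinates `(z, u)`, where `z` is the
coordinate of the base point and the flag is spanned by the columns of `g * lowerUni u`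
in the given trivialization, `g` being a fixed frame for `x`. -/
def chart (x : FlagBundle n E) : PartialEquiv (FlagBundle n E) (ℂ × (LowerIdx n → ℂ)) where
  source := {y | y.base ∈ (chartAt ℂ x.base).source ∩ x.triv.baseSet ∧
    ∃ u, ∀ j, trivFlag x.triv y j = colSpan (x.frame * lowerUni u) j}
  target := {a | a.1 ∈ (chartAt ℂ x.base).target ∧ (chartAt ℂ x.base).symm a.1 ∈ x.triv.baseSet}
  toFun y := (chartAt ℂ x.base y.base,
    if h : ∃ u, ∀ j, trivFlag x.triv y j = colSpan (x.frame * lowerUni u) j then h.choose else 0)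
  invFun a := if h : (chartAt ℂ x.base).symm a.1 ∈ x.triv.baseSet then
    ofFrame x.triv h (x.frame * lowerUni a.2) (x.det_frame_mul a.2) else x
  map_source' := by
    rintro y ⟨⟨h1, h2⟩, -⟩
    exact ⟨(chartAt ℂ x.base).map_source h1, by simpa [(chartAt ℂ x.base).left_inv h1] using h2⟩
  map_target' := by
    rintro a ⟨h1, h2⟩
    simp only [h2, dite_true]
    exact ⟨⟨(chartAt ℂ x.base).map_target h1, h2⟩, a.2, trivFlag_ofFrame _ _ _ _⟩
  left_inv' := by
    rintro y ⟨⟨h1, h2⟩, h⟩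
    have h3 : (chartAt ℂ x.base).symm (chartAt ℂ x.base y.base) = y.base :=
      (chartAt ℂ x.base).left_inv h1
    have h4 : (chartAt ℂ x.base).symm (chartAt ℂ x.base y.base) ∈ x.triv.baseSet := by rwa [h3]
    simp only [h, h4, dite_true]
    refine ext_of_trivFlag x.triv h4 h3 fun j => ?_
    rw [trivFlag_ofFrame, h.choose_spec]
  right_inv' := by
    rintro a ⟨h1, h2⟩
    have h3 := trivFlag_ofFrame x.triv h2 (x.frame * lowerUni a.2) (x.det_frame_mul a.2)
    have h4 : ∃ u, ∀ j, trivFlag x.triv (ofFrame x.triv h2 (x.frame * lowerUni a.2)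
        (x.det_frame_mul a.2)) j = colSpan (x.frame * lowerUni u) j := ⟨_, h3⟩
    simp only [h2, dite_true, h4]
    refine Prod.ext ((chartAt ℂ x.base).right_inv h1) ?_
    refine lowerUni_inj fun j => colSpan_cancel x.det_frame ?_
    rw [← h3, h4.choose_spec]

open Classical in
theorem chart_symm_base (x : FlagBundle n E) {a : ℂ × (LowerIdx n → ℂ)}
    (ha : a ∈ x.chart.target) : (x.chart.symm a).base = (chartAt ℂ x.base).symm a.1 := by
  change (dite _ _ _ : FlagBundle n E).base = _
  rw [dif_pos ha.2]
  rfl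

open Classical in
theorem trivFlag_chart_symm (x : FlagBundle n E) {a : ℂ × (LowerIdx n → ℂ)}
    (ha : a ∈ x.chart.target) (j : Fin (n + 1)) :
    trivFlag x.triv (x.chart.symm a) j = colSpan (x.frame * lowerUni a.2) j := by
  change trivFlag x.triv (dite _ _ _ : FlagBundle n E) j = _
  rw [dif_pos ha.2, trivFlag_ofFrame]

theorem mem_chart_source (x : FlagBundle n E) : x ∈ x.chart.source := by
  refine ⟨⟨_root_.mem_chart_source ℂ x.base, mem_baseSet_trivializationAt _ _ _⟩, 0, fun j => ?_⟩
  have : lowerUni (0 : LowerIdx n → ℂ) = 1 := by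
    ext r c; by_cases h : r = c <;> simp [lowerUni, Matrix.one_apply, h]
  rw [this, mul_one, trivFlag_self]

open Classical in
theorem chart_snd {x y : FlagBundle n E} {u : LowerIdx n → ℂ}
    (h : ∀ j, trivFlag x.triv y j = colSpan (x.frame * lowerUni u) j) : (x.chart y).2 = u := by
  change (dite _ _ _ : LowerIdx n → ℂ) = u
  rw [dif_pos ⟨u, h⟩]
  refine lowerUni_inj fun j => colSpan_cancel x.det_frame ?_
  rw [← h, (⟨u, h⟩ : ∃ u, ∀ j, trivFlag x.triv y j = colSpan (x.frame * lowerUni u) j).choose_spec]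

/-- The matrix relating the frames used in two charts. -/
def changeMat (x y : FlagBundle n E) (a : ℂ × (LowerIdx n → ℂ)) : Matrix (Fin n) (Fin n) ℂ :=
  y.frame⁻¹ * (LinearMap.toMatrix' (x.triv.coordChangeL ℂ y.triv
    ((chartAt ℂ x.base).symm a.1)).toLinearMap * (x.frame * lowerUni a.2))

theorem trivFlag_change (e e' : Trivialization (Fin n → ℂ) (π (Fin n → ℂ) E)) [e.IsLinear ℂ]
    [e'.IsLinear ℂ] (x : FlagBundle n E) (h : x.base ∈ e.baseSet) (h' : x.base ∈ e'.baseSet)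
    (j : Fin (n + 1)) :
    trivFlag e' x j = (trivFlag e x j).map (e.coordChangeL ℂ e' x.base).toLinearMap := by
  rw [trivFlag, trivFlag, ← Submodule.map_comp]
  congr 1
  ext v : 1
  have : (e.coordChangeL ℂ e' x.base) (e.linearMapAt ℂ x.base v) = e'.linearMapAt ℂ x.base v := by
    rw [Trivialization.coordChangeL_apply _ _ ⟨h, h'⟩, e.coe_linearMapAt_of_mem h,
      e'.coe_linearMapAt_of_mem h']
    simp [e.symm_apply_apply_mk h]
  exact this.symm

theorem trivFlag_chart_symm_change (x y : FlagBundle n E) {a : ℂ × (LowerIdx n → ℂ)}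
    (ha : a ∈ x.chart.target) (h : (x.chart.symm a).base ∈ y.triv.baseSet) (j : Fin (n + 1)) :
    trivFlag y.triv (x.chart.symm a) j = colSpan (y.frame * changeMat x y a) j := by
  have h0 : (x.chart.symm a).base ∈ x.triv.baseSet := by rw [chart_symm_base x ha]; exact ha.2
  rw [trivFlag_change x.triv y.triv _ h0 h, trivFlag_chart_symm x ha, changeMat,
    Matrix.mul_nonsing_inv_cancel_left _ _ (isUnit_iff_ne_zero.2 y.det_frame), chart_symm_base x ha,
    colSpan_mul _ (x.frame * lowerUni a.2), Matrix.toLin'_toMatrix']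

theorem det_changeMat (x y : FlagBundle n E) (a : ℂ × (LowerIdx n → ℂ)) :
    (changeMat x y a).det ≠ 0 := by
  rw [changeMat, Matrix.det_mul, Matrix.det_mul, LinearMap.det_toMatrix']
  refine mul_ne_zero ?_ (mul_ne_zero ?_ (x.det_frame_mul _))
  · have := (isUnit_iff_ne_zero.2 y.det_frame)
    exact (Matrix.isUnit_nonsing_inv_det _ this).ne_zero
  · exact (LinearEquiv.isUnit_det' (x.triv.coordChangeL ℂ y.triv
      ((chartAt ℂ x.base).symm a.1)).toLinearEquiv).ne_zero

theorem mem_trans_source (x y : FlagBundle n E) (a : ℂ × (LowerIdx n → ℂ)) :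
    a ∈ (x.chart.symm.trans y.chart).source ↔ a ∈ x.chart.target ∧
      (chartAt ℂ x.base).symm a.1 ∈ (chartAt ℂ y.base).source ∩ y.triv.baseSet ∧
      IsBig (changeMat x y a) := by
  rw [PartialEquiv.trans_source, PartialEquiv.symm_source]
  refine and_congr_right fun ha => ?_
  change (_ ∧ _) ↔ _
  rw [chart_symm_base x ha]
  refine and_congr_right fun h => ?_
  have key := trivFlag_chart_symm_change x y ha (by rw [chart_symm_base x ha]; exact h.2)
  constructor
  · rintro ⟨u, hu⟩
    refine isBig_of_colSpan_eq (det_changeMat x y a) (u := u) fun j => ?_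
    exact colSpan_cancel y.det_frame (by rw [← key, hu])
  · intro hb
    refine ⟨lowerPart (changeMat x y a), fun j => ?_⟩
    rw [key, colSpan_mul, ← colSpan_lowerPart hb, ← colSpan_mul]

theorem trans_apply (x y : FlagBundle n E) {a : ℂ × (LowerIdx n → ℂ)}
    (ha : a ∈ (x.chart.symm.trans y.chart).source) :
    x.chart.symm.trans y.chart a =
      (chartAt ℂ y.base ((chartAt ℂ x.base).symm a.1), lowerPart (changeMat x y a)) := by
  obtain ⟨h1, h2, h3⟩ := (mem_trans_source x y a).1 ha
  change y.chart (x.chart.symm a) = _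
  refine Prod.ext ?_ (chart_snd fun j => ?_)
  · change chartAt ℂ y.base (x.chart.symm a).base = _
    rw [chart_symm_base x h1]
  · rw [trivFlag_chart_symm_change x y h1 (by rw [chart_symm_base x h1]; exact h2.2),
      colSpan_mul, ← colSpan_lowerPart h3, ← colSpan_mul]

variable [IsManifold 𝓘(ℂ) ω C] [ContMDiffVectorBundle ω (Fin n → ℂ) E 𝓘(ℂ)]

theorem contDiffAt_changeMat (x y : FlagBundle n E) {a : ℂ × (LowerIdx n → ℂ)}
    (h1 : a ∈ x.chart.target) (h2 : (chartAt ℂ x.base).symm a.1 ∈ y.triv.baseSet) (r c : Fin n) :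
    ContDiffAt ℂ ω (fun b => changeMat x y b r c) a := by
  have hT : ContDiffAt ℂ ω (fun z : ℂ => (x.triv.coordChangeL ℂ y.triv
      ((chartAt ℂ x.base).symm z) : (Fin n → ℂ) →L[ℂ] (Fin n → ℂ))) a.1 := by
    rw [← contMDiffAt_iff_contDiffAt]
    have h3 : ContMDiffAt 𝓘(ℂ) 𝓘(ℂ) ω (chartAt ℂ x.base).symm a.1 :=
      contMDiffOn_chart_symm.contMDiffAt ((chartAt ℂ x.base).open_target.mem_nhds h1.1)
    exact (contMDiffAt_coordChangeL (n := ω) (IB := 𝓘(ℂ)) (e := x.triv) (e' := y.triv)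
      h1.2 h2).comp a.1 h3
  have hT' : ∀ i j, ContDiffAt ℂ ω (fun b : ℂ × (LowerIdx n → ℂ) =>
      LinearMap.toMatrix' (x.triv.coordChangeL ℂ y.triv
        ((chartAt ℂ x.base).symm b.1)).toLinearMap i j) a := by
    intro i j
    have h5 := (hT.comp a contDiffAt_fst).clm_apply
      (contDiffAt_const (c := (Pi.single j 1 : Fin n → ℂ)))
    have := (contDiffAt_pi.1 h5) i
    refine this.congr_of_eventuallyEq (Filter.Eventually.of_forall fun b => ?_)
    simp [LinearMap.toMatrix'_apply]
  unfold changeMat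
  simp only [Matrix.mul_apply]
  refine ContDiffAt.sum fun i _ => contDiffAt_const.mul (ContDiffAt.sum fun j _ =>
    (hT' i j).mul (ContDiffAt.sum fun k _ => contDiffAt_const.mul (contDiffAt_lowerUni a k c)))

theorem isOpen_chart_target (x : FlagBundle n E) : IsOpen x.chart.target := by
  have : x.chart.target = Prod.fst ⁻¹' ((chartAt ℂ x.base).target ∩
      (chartAt ℂ x.base).symm ⁻¹' x.triv.baseSet) := rfl
  rw [this]
  exact ((chartAt ℂ x.base).symm.isOpen_inter_preimage x.triv.open_baseSet).preimage continuous_fst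

theorem isOpen_trans_source (x y : FlagBundle n E) :
    IsOpen (x.chart.symm.trans y.chart).source := by
  rw [isOpen_iff_mem_nhds]
  intro a ha
  obtain ⟨h1, h2, h3⟩ := (mem_trans_source x y a).1 ha
  have e1 : ∀ᶠ b in 𝓝 a, b ∈ x.chart.target := (isOpen_chart_target x).mem_nhds h1
  have e2 : ∀ᶠ b : ℂ × (LowerIdx n → ℂ) in 𝓝 a, (chartAt ℂ x.base).symm b.1 ∈
      (chartAt ℂ y.base).source ∩ y.triv.baseSet := by
    have hc : ContinuousAt (fun b : ℂ × (LowerIdx n → ℂ) => (chartAt ℂ x.base).symm b.1) a :=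
      ((chartAt ℂ x.base).continuousAt_symm h1.1).comp continuousAt_fst
    exact hc.eventually (((chartAt ℂ y.base).open_source.inter y.triv.open_baseSet).mem_nhds h2)
  have e3 := eventually_isBig (contDiffAt_changeMat x y h1 h2.2) h3
  filter_upwards [e1, e2, e3] with b hb1 hb2 hb3
  exact (mem_trans_source x y b).2 ⟨hb1, hb2, hb3⟩

theorem contDiffOn_trans (x y : FlagBundle n E) :
    ContDiffOn ℂ ω (x.chart.symm.trans y.chart) (x.chart.symm.trans y.chart).source := by
  have key : ContDiffOn ℂ ω (fun a : ℂ × (LowerIdx n → ℂ) =>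
      (chartAt ℂ y.base ((chartAt ℂ x.base).symm a.1), lowerPart (changeMat x y a)))
      (x.chart.symm.trans y.chart).source := by
    intro a ha
    obtain ⟨h1, h2, h3⟩ := (mem_trans_source x y a).1 ha
    refine ContDiffAt.contDiffWithinAt (ContDiffAt.prodMk ?_
      (contDiffAt_lowerPart (contDiffAt_changeMat x y h1 h2.2) h3))
    have h4 : ContMDiffAt 𝓘(ℂ) 𝓘(ℂ) ω (chartAt ℂ x.base).symm a.1 :=
      contMDiffOn_chart_symm.contMDiffAt ((chartAt ℂ x.base).open_target.mem_nhds h1.1)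
    have h5 : ContMDiffAt 𝓘(ℂ) 𝓘(ℂ) ω (chartAt ℂ y.base) ((chartAt ℂ x.base).symm a.1) :=
      contMDiffOn_chart.contMDiffAt ((chartAt ℂ y.base).open_source.mem_nhds h2.1)
    have h6 := contMDiffAt_iff_contDiffAt.1 (h5.comp a.1 h4)
    exact h6.comp a contDiffAt_fst
  exact key.congr fun a ha => trans_apply x y ha

variable (n E) in
/-- The charts of the complex manifold `Fl(E)`. -/
def core : ChartedSpaceCore (ℂ × (LowerIdx n → ℂ)) (FlagBundle n E) where
  atlas := Set.range chart
  chartAt := chart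
  mem_chart_source := mem_chart_source
  chart_mem_atlas x := Set.mem_range_self x
  open_source := by
    rintro _ _ ⟨x, rfl⟩ ⟨y, rfl⟩
    exact isOpen_trans_source x y
  continuousOn_toFun := by
    rintro _ _ ⟨x, rfl⟩ ⟨y, rfl⟩
    exact (contDiffOn_trans x y).continuousOn

instance : TopologicalSpace (FlagBundle n E) := (core n E).toTopologicalSpace

instance : ChartedSpace (ℂ × (LowerIdx n → ℂ)) (FlagBundle n E) := (core n E).toChartedSpace

instance : IsManifold 𝓘(ℂ, ℂ × (LowerIdx n → ℂ)) ω (FlagBundle n E) := by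
  refine isManifold_of_contDiffOn _ _ _ fun e e' he he' => ?_
  obtain ⟨_, ⟨x, rfl⟩, rfl⟩ : ∃ c, ∃ h : c ∈ (core n E).atlas,
      e = (core n E).openPartialHomeomorph c h := by
    simpa [atlas, ChartedSpace.atlas] using he
  obtain ⟨_, ⟨y, rfl⟩, rfl⟩ : ∃ c, ∃ h : c ∈ (core n E).atlas,
      e' = (core n E).openPartialHomeomorph c h := by
    simpa [atlas, ChartedSpace.atlas] using he'
  have := contDiffOn_trans x y
  simp only [modelWithCornersSelf_coe, modelWithCornersSelf_coe_symm, Function.id_comp,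
    Function.comp_id, Set.preimage_id, Set.range_id, Set.inter_univ]
  exact this

theorem contMDiff_base : ContMDiff 𝓘(ℂ, ℂ × (LowerIdx n → ℂ)) 𝓘(ℂ) ω
    (FlagBundle.base : FlagBundle n E → C) := by
  intro x
  have h1 : ContMDiffAt 𝓘(ℂ, ℂ × (LowerIdx n → ℂ)) 𝓘(ℂ, ℂ × (LowerIdx n → ℂ)) ω
      (chartAt (ℂ × (LowerIdx n → ℂ)) x) x :=
    contMDiffOn_chart.contMDiffAt ((chartAt _ x).open_source.mem_nhds (_root_.mem_chart_source _ x))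
  have h2 : ContMDiffAt 𝓘(ℂ, ℂ × (LowerIdx n → ℂ)) 𝓘(ℂ) ω (Prod.fst : ℂ × (LowerIdx n → ℂ) → ℂ)
      (chartAt (ℂ × (LowerIdx n → ℂ)) x x) := contMDiffAt_iff_contDiffAt.2 contDiffAt_fst
  have h3 : ContMDiffAt 𝓘(ℂ) 𝓘(ℂ) ω (chartAt ℂ x.base).symm
      (chartAt (ℂ × (LowerIdx n → ℂ)) x x).1 :=
    contMDiffOn_chart_symm.contMDiffAt ((chartAt ℂ x.base).open_target.mem_nhds
      (mem_chart_target ℂ x.base))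
  refine (h3.comp x (h2.comp x h1)).congr_of_eventuallyEq ?_
  filter_upwards [(chartAt (ℂ × (LowerIdx n → ℂ)) x).open_source.mem_nhds
    (_root_.mem_chart_source _ x)] with y hy
  exact ((chartAt ℂ x.base).left_inv hy.1.1).symm

end FlagBundle

/-- A square root `K^{1/2}` of the canonical bundle of a Riemann surface `C`, given by holomorphic
transition functions `root i j` over an atlas of holomorphic coordinates `z i = chart i`, with
`(root i j)² = dz j / dz i`. -/
structure SpinStructure (C : Type*) [TopologicalSpace C] [ChartedSpace ℂ C] (ι : Type*) where
  chart : ι → OpenPartialHomeomorph C ℂ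
  chart_mem : ∀ i, chart i ∈ IsManifold.maximalAtlas 𝓘(ℂ) ω C
  indexAt : C → ι
  mem_source : ∀ x, x ∈ (chart (indexAt x)).source
  root : ι → ι → C → ℂ
  contMDiffOn_root : ∀ i j, ContMDiffOn 𝓘(ℂ) 𝓘(ℂ) ω (root i j) ((chart i).source ∩ (chart j).source)
  root_sq : ∀ i j, ∀ x ∈ (chart i).source ∩ (chart j).source,
    root i j x ^ 2 = deriv (fun w => chart j ((chart i).symm w)) (chart i x)
  root_mul : ∀ i j k, ∀ x ∈ (chart i).source ∩ (chart j).source ∩ (chart k).source,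
    root i j x * root j k x = root i k x

theorem iteratedDeriv_sub_pow_div (k q : ℕ) (t₀ : ℂ) :
    iteratedDeriv k (fun t : ℂ => (t - t₀) ^ q / (q.factorial : ℂ)) t₀ = if k = q then 1 else 0 := by
  have h := congrFun (iteratedDeriv_comp_sub_const (n := k)
    (f := fun t : ℂ => t ^ q / (q.factorial : ℂ)) (s := t₀)) t₀
  simp only [sub_self] at h
  rw [h]
  have h2 : iteratedDeriv k (fun t : ℂ => t ^ q / (q.factorial : ℂ)) 0 =
      iteratedDeriv k (fun t : ℂ => t ^ q) 0 / (q.factorial : ℂ) := by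
    simp only [div_eq_mul_inv]
    exact iteratedDeriv_mul_const_field _ _
  rw [h2, iteratedDeriv_fun_pow_zero]
  by_cases hk : k = q
  · subst hk
    rw [if_pos rfl, if_pos rfl]
    exact div_self (Nat.cast_ne_zero.2 k.factorial_ne_zero)
  · simp [hk]

theorem iteratedDeriv_mul_comp_eq_zero {n r : ℕ} (hr : r < n) {g τ R : ℂ → ℂ} {w₀ : ℂ}
    (hg : AnalyticAt ℂ g w₀) (hτ : AnalyticAt ℂ τ w₀) (hR : AnalyticAt ℂ R (τ w₀))
    (hR0 : ∀ k < n, iteratedDeriv k R (τ w₀) = 0) :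
    iteratedDeriv r (fun w => g w * R (τ w)) w₀ = 0 := by
  obtain ⟨h, hh, hh'⟩ := (natCast_le_analyticOrderAt hR).1
    ((natCast_le_analyticOrderAt_iff_iteratedDeriv_eq_zero hR).2 hR0)
  have hτ' : AnalyticAt ℂ (fun w => τ w - τ w₀) w₀ := hτ.sub analyticAt_const
  obtain ⟨s, hs, hs'⟩ := (natCast_le_analyticOrderAt hτ' (n := 1)).1
    ((natCast_le_analyticOrderAt_iff_iteratedDeriv_eq_zero hτ').2 fun k hk => by
      obtain rfl : k = 0 := by omega
      simp)
  have hA : AnalyticAt ℂ (fun w => g w * R (τ w)) w₀ := hg.mul (hR.comp hτ)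
  refine (natCast_le_analyticOrderAt_iff_iteratedDeriv_eq_zero hA).1
    ((natCast_le_analyticOrderAt hA).2 ⟨fun w => g w * (s w ^ n * h (τ w)),
      hg.mul ((hs.pow n).mul (hh.comp hτ)), ?_⟩) r hr
  filter_upwards [hτ.continuousAt.eventually hh', hs'] with w h1 h2
  rw [h1, h2]
  simp only [smul_eq_mul, pow_one, mul_pow]
  ring

/-- The jet at `w₀` of `w ↦ g w * h (τ w)` depends linearly on the jet of `h` at `τ w₀`. -/
theorem iteratedDeriv_mul_comp {n r : ℕ} (hr : r < n) {g τ h : ℂ → ℂ} {w₀ : ℂ}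
    (hg : AnalyticAt ℂ g w₀) (hτ : AnalyticAt ℂ τ w₀) (hh : AnalyticAt ℂ h (τ w₀)) :
    iteratedDeriv r (fun w => g w * h (τ w)) w₀ = ∑ q : Fin n,
      iteratedDeriv r (fun w => g w * ((τ w - τ w₀) ^ (q : ℕ) / ((q : ℕ).factorial : ℂ))) w₀ *
        iteratedDeriv q h (τ w₀) := by
  set P : Fin n → ℂ → ℂ := fun q t => (t - τ w₀) ^ (q : ℕ) / ((q : ℕ).factorial : ℂ) with hP
  have hPa : ∀ q t, AnalyticAt ℂ (P q) t := fun q t =>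
    ((analyticAt_id.sub analyticAt_const).pow _).div_const
  set R : ℂ → ℂ := fun t => h t - ∑ q : Fin n, iteratedDeriv q h (τ w₀) * P q t with hR
  have hsum : AnalyticAt ℂ (fun t => ∑ q : Fin n, iteratedDeriv q h (τ w₀) * P q t) (τ w₀) :=
    Finset.analyticAt_fun_sum _ fun q _ => analyticAt_const.mul (hPa q _)
  have hRa : AnalyticAt ℂ R (τ w₀) := hh.sub hsum
  have hR0 : ∀ k < n, iteratedDeriv k R (τ w₀) = 0 := by
    intro k hk
    have e1 : iteratedDeriv k R (τ w₀) = iteratedDeriv k h (τ w₀) -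
        iteratedDeriv k (fun t => ∑ q : Fin n, iteratedDeriv q h (τ w₀) * P q t) (τ w₀) :=
      iteratedDeriv_fun_sub hh.contDiffAt hsum.contDiffAt
    have hPc : ∀ q : Fin n, AnalyticAt ℂ (fun t => iteratedDeriv q h (τ w₀) * P q t) (τ w₀) :=
      fun q => analyticAt_const.mul (hPa q _)
    rw [e1, iteratedDeriv_fun_sum fun q _ => (hPc q).contDiffAt]
    have e2 : ∀ q : Fin n, iteratedDeriv k (fun t => iteratedDeriv q h (τ w₀) * P q t) (τ w₀) =
        if k = (q : ℕ) then iteratedDeriv q h (τ w₀) else 0 := fun q => by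
      rw [iteratedDeriv_const_mul_field, hP, iteratedDeriv_sub_pow_div]
      simp
    rw [Finset.sum_congr rfl fun q _ => e2 q, Finset.sum_eq_single (⟨k, hk⟩ : Fin n)]
    · simp
    · intro q _ hq
      rw [if_neg]
      rintro rfl
      exact hq rfl
    · simp
  have key := iteratedDeriv_mul_comp_eq_zero hr hg hτ hRa hR0
  have hPτ : ∀ q : Fin n, AnalyticAt ℂ (fun w => g w * P q (τ w)) w₀ := fun q =>
    hg.mul ((hPa q _).comp hτ)
  have e3 : (fun w => g w * h (τ w)) = fun w => g w * R (τ w) +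
      ∑ q : Fin n, iteratedDeriv q h (τ w₀) * (g w * P q (τ w)) := by
    funext w
    simp only [hR, mul_sub, Finset.mul_sum]
    rw [sub_add_eq_add_sub, eq_sub_iff_add_eq]
    congr 1
    exact Finset.sum_congr rfl fun q _ => by ring
  have hPc : ∀ q : Fin n, AnalyticAt ℂ
      (fun w => iteratedDeriv q h (τ w₀) * (g w * P q (τ w))) w₀ :=
    fun q => analyticAt_const.mul (hPτ q)
  have hgR : AnalyticAt ℂ (fun w => g w * R (τ w)) w₀ := hg.mul (hRa.comp hτ)
  rw [e3, iteratedDeriv_fun_add hgR.contDiffAt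
    (Finset.analyticAt_fun_sum _ fun q _ => hPc q).contDiffAt, key, zero_add,
    iteratedDeriv_fun_sum fun q _ => (hPc q).contDiffAt]
  refine Finset.sum_congr rfl fun q _ => ?_
  rw [iteratedDeriv_const_mul_field, mul_comm]

/-- A family of endomorphisms of `ℂⁿ` is holomorphic if its matrix entries are. -/
theorem contMDiffOn_endo {C : Type*} [TopologicalSpace C] [ChartedSpace ℂ C] {n : ℕ}
    {f : C → (Fin n → ℂ) →L[ℂ] (Fin n → ℂ)} {s : Set C}
    (h : ∀ r q, ContMDiffOn 𝓘(ℂ) 𝓘(ℂ) ω (fun x => f x (Pi.single q 1) r) s) :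
    ContMDiffOn 𝓘(ℂ) 𝓘(ℂ, (Fin n → ℂ) →L[ℂ] (Fin n → ℂ)) ω f s := by
  let L : (Fin n → Fin n → ℂ) →ₗ[ℂ] ((Fin n → ℂ) →L[ℂ] (Fin n → ℂ)) :=
    LinearMap.toContinuousLinearMap.toLinearMap ∘ₗ
      (Matrix.toLin' (R := ℂ) (m := Fin n) (n := Fin n)).toLinearMap
  have h1 : ContMDiffOn 𝓘(ℂ) 𝓘(ℂ, Fin n → Fin n → ℂ) ω
      (fun x => fun r q => f x (Pi.single q 1) r) s :=
    contMDiffOn_pi_space.2 fun r => contMDiffOn_pi_space.2 fun q => h r q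
  have h2 := (LinearMap.toContinuousLinearMap L).contMDiff (n := ω).comp_contMDiffOn h1
  refine h2.congr fun x _ => ?_
  have : Matrix.of (fun r q => f x (Pi.single q 1) r) = LinearMap.toMatrix' (f x).toLinearMap := by
    ext r q
    simp [LinearMap.toMatrix'_apply]
  change f x = LinearMap.toContinuousLinearMap
    (Matrix.toLin' (Matrix.of (fun r q => f x (Pi.single q 1) r)))
  rw [this, Matrix.toLin'_toMatrix']
  rfl

namespace SpinStructure

variable {C ι : Type*} [TopologicalSpace C] [ChartedSpace ℂ C] (S : SpinStructure C ι)

/-- The domain `U i` of the coordinate `z i`. -/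
abbrev dom (i : ι) : Set C := (S.chart i).source

/-- The coordinate `z i` as a function of `z j`. -/
def coord (j i : ι) (w : ℂ) : ℂ := S.chart i ((S.chart j).symm w)

/-- The transition function `(dz i / dz j)^{m/2}` of `K^{m/2}` as a function of `z j`. -/
def factor (m : ℤ) (j i : ι) (w : ℂ) : ℂ := S.root j i ((S.chart j).symm w) ^ m

theorem root_self {i : ι} {x : C} (hx : x ∈ S.dom i) : S.root i i x = 1 := by
  have h := S.root_sq i i x ⟨hx, hx⟩
  have h1 : deriv (fun w => S.chart i ((S.chart i).symm w)) (S.chart i x) = 1 := by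
    have : (fun w => S.chart i ((S.chart i).symm w)) =ᶠ[𝓝 (S.chart i x)] id := by
      filter_upwards [(S.chart i).open_target.mem_nhds ((S.chart i).map_source hx)] with w hw
      exact (S.chart i).right_inv hw
    rw [this.deriv_eq, deriv_id]
  rw [h1] at h
  have h2 := S.root_mul i i i x ⟨⟨hx, hx⟩, hx⟩
  rw [← h2, ← pow_two, h]

theorem root_ne_zero {i j : ι} {x : C} (hi : x ∈ S.dom i) (hj : x ∈ S.dom j) :
    S.root i j x ≠ 0 := by
  intro h
  have := S.root_mul i j i x ⟨⟨hi, hj⟩, hi⟩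
  rw [h, zero_mul, S.root_self hi] at this
  exact zero_ne_one this

theorem contMDiffOn_root_zpow (m : ℤ) (i j : ι) :
    ContMDiffOn 𝓘(ℂ) 𝓘(ℂ) ω (fun x => S.root i j x ^ m) (S.dom i ∩ S.dom j) := by
  intro x hx
  have h1 : ContMDiffAt 𝓘(ℂ) 𝓘(ℂ) ω (fun z : ℂ => z ^ m) (S.root i j x) :=
    contMDiffAt_iff_contDiffAt.2
      ((analyticAt_id (𝕜 := ℂ)).zpow (S.root_ne_zero hx.1 hx.2)).contDiffAt
  exact h1.comp_contMDiffWithinAt x (S.contMDiffOn_root i j x hx)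

/-- The line bundle `K^{m/2}`: a section is a family of functions `f i` on `U i` with
`f i = (dz j / dz i)^{m/2} f j`. -/
def canonicalPow (m : ℤ) : VectorBundleCore ℂ C ℂ ι where
  baseSet := S.dom
  isOpen_baseSet i := (S.chart i).open_source
  indexAt := S.indexAt
  mem_baseSet_at := S.mem_source
  coordChange i j x := S.root j i x ^ m • ContinuousLinearMap.id ℂ ℂ
  coordChange_self i x hx v := by simp [S.root_self hx]
  continuousOn_coordChange i j := by
    have := (S.contMDiffOn_root_zpow m j i).continuousOn
    rw [inter_comm]
    exact this.smul continuousOn_const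
  coordChange_comp i j k x hx v := by
    have := S.root_mul k j i x ⟨⟨hx.2, hx.1.2⟩, hx.1.1⟩
    simp [← this, mul_zpow, mul_assoc]

instance (m : ℤ) : (S.canonicalPow m).IsContMDiff 𝓘(ℂ) ω where
  contMDiffOn_coordChange i j := by
    change ContMDiffOn _ _ _ (fun x => S.root j i x ^ m • ContinuousLinearMap.id ℂ ℂ) (S.dom i ∩ S.dom j)
    rw [inter_comm]
    exact (S.contMDiffOn_root_zpow m j i).smul contMDiffOn_const

/-- The direct sum `K^{d 0 / 2} ⊕ ⋯ ⊕ K^{d (n - 1) / 2}`. -/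
def canonicalSum {n : ℕ} (d : Fin n → ℤ) : VectorBundleCore ℂ C (Fin n → ℂ) ι where
  baseSet := S.dom
  isOpen_baseSet i := (S.chart i).open_source
  indexAt := S.indexAt
  mem_baseSet_at := S.mem_source
  coordChange i j x := ContinuousLinearMap.pi fun r =>
    ((S.canonicalPow (d r)).coordChange i j x).comp (ContinuousLinearMap.proj r)
  coordChange_self i x hx v := by
    ext r; exact (S.canonicalPow (d r)).coordChange_self i x hx (v r)
  continuousOn_coordChange i j := by
    refine continuousOn_clm_apply.2 fun v => continuousOn_pi.2 fun r => ?_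
    exact ((S.canonicalPow (d r)).continuousOn_coordChange i j).clm_apply continuousOn_const
  coordChange_comp i j k x hx v := by
    ext r; exact (S.canonicalPow (d r)).coordChange_comp i j k x hx (v r)

instance {n : ℕ} (d : Fin n → ℤ) : (S.canonicalSum d).IsContMDiff 𝓘(ℂ) ω where
  contMDiffOn_coordChange i j := by
    refine contMDiffOn_endo fun r q => ?_
    change ContMDiffOn _ _ _ (fun x => S.root j i x ^ d r * (Pi.single q 1 : Fin n → ℂ) r)
      (S.dom i ∩ S.dom j)
    rw [inter_comm]
    exact (S.contMDiffOn_root_zpow (d r) j i).mul contMDiffOn_const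

/-- The matrix carrying jets of order `< n` of sections of `K^{m/2}` at `x`, in the coordinate
`z i`, to jets in the coordinate `z j`. The entry `(r, q)` is the `r`-th derivative with respect to
`z j` at `x` of the local expression over `U j` of the section which is given over `U i` by
`(z i - z i x)^q / q!`. -/
def jetMatrix (n : ℕ) (m : ℤ) (i j : ι) (x : C) : Matrix (Fin n) (Fin n) ℂ :=
  fun r q => iteratedDeriv r (fun w => S.factor m j i w *
    ((S.coord j i w - S.chart i x) ^ (q : ℕ) / ((q : ℕ).factorial : ℂ))) (S.chart j x)

theorem analyticAt_coord {i j : ι} {x : C} (hi : x ∈ S.dom i) (hj : x ∈ S.dom j) :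
    AnalyticAt ℂ (S.coord j i) (S.chart j x) := by
  have h1 : ContMDiffAt 𝓘(ℂ) 𝓘(ℂ) ω (S.chart j).symm (S.chart j x) :=
    (contMDiffOn_symm_of_mem_maximalAtlas (S.chart_mem j)).contMDiffAt
      ((S.chart j).open_target.mem_nhds ((S.chart j).map_source hj))
  have h2 : ContMDiffAt 𝓘(ℂ) 𝓘(ℂ) ω (S.chart i) ((S.chart j).symm (S.chart j x)) := by
    rw [(S.chart j).left_inv hj]
    exact (contMDiffOn_of_mem_maximalAtlas (S.chart_mem i)).contMDiffAt
      ((S.chart i).open_source.mem_nhds hi)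
  exact (contMDiffAt_iff_contDiffAt.1 (h2.comp _ h1)).analyticAt

theorem analyticAt_factor (m : ℤ) {i j : ι} {x : C} (hi : x ∈ S.dom i) (hj : x ∈ S.dom j) :
    AnalyticAt ℂ (S.factor m j i) (S.chart j x) := by
  have h1 : ContMDiffAt 𝓘(ℂ) 𝓘(ℂ) ω (S.chart j).symm (S.chart j x) :=
    (contMDiffOn_symm_of_mem_maximalAtlas (S.chart_mem j)).contMDiffAt
      ((S.chart j).open_target.mem_nhds ((S.chart j).map_source hj))
  have h2 : ContMDiffAt 𝓘(ℂ) 𝓘(ℂ) ω (fun y => S.root j i y ^ m)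
      ((S.chart j).symm (S.chart j x)) := by
    rw [(S.chart j).left_inv hj]
    exact (S.contMDiffOn_root_zpow m j i).contMDiffAt
      (((S.chart j).open_source.inter (S.chart i).open_source).mem_nhds ⟨hj, hi⟩)
  exact (contMDiffAt_iff_contDiffAt.1 (h2.comp _ h1)).analyticAt

theorem coord_chart {i j : ι} {x : C} (hj : x ∈ S.dom j) :
    S.coord j i (S.chart j x) = S.chart i x := by
  rw [coord, (S.chart j).left_inv hj]

/-- If a section of `K^{m/2}` is given by `h` near `x` in the coordinate `z i`, then `jetMatrix`
carries its jet in the coordinate `z i` to its jet in the coordinate `z j`. -/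
theorem jetMatrix_mulVec {n : ℕ} (m : ℤ) {i j : ι} {x : C} (hi : x ∈ S.dom i) (hj : x ∈ S.dom j)
    {h : ℂ → ℂ} (hh : AnalyticAt ℂ h (S.chart i x)) :
    S.jetMatrix n m i j x *ᵥ (fun q : Fin n => iteratedDeriv q h (S.chart i x)) =
      fun r : Fin n => iteratedDeriv r (fun w => S.factor m j i w * h (S.coord j i w))
        (S.chart j x) := by
  ext r
  have hc := S.coord_chart (i := i) hj
  rw [← hc] at hh
  rw [iteratedDeriv_mul_comp r.2 (S.analyticAt_factor m hi hj) (S.analyticAt_coord hi hj) hh, hc]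
  rfl

theorem jetMatrix_upper {n : ℕ} (m : ℤ) {i j : ι} {x : C} (hi : x ∈ S.dom i) (hj : x ∈ S.dom j)
    {r q : Fin n} (h : r < q) : S.jetMatrix n m i j x r q = 0 := by
  have hc := S.coord_chart (i := i) hj
  refine iteratedDeriv_mul_comp_eq_zero (n := q) h (S.analyticAt_factor m hi hj)
    (S.analyticAt_coord hi hj)
    (R := fun t => (t - S.chart i x) ^ (q : ℕ) / ((q : ℕ).factorial : ℂ))
    ((analyticAt_id.sub analyticAt_const).pow _).div_const fun k hk => ?_
  rw [hc, iteratedDeriv_sub_pow_div, if_neg hk.ne]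

theorem jetMatrix_self {n : ℕ} (m : ℤ) {i : ι} {x : C} (hi : x ∈ S.dom i) :
    S.jetMatrix n m i i x = 1 := by
  ext r q
  have h : (fun w => S.factor m i i w *
      ((S.coord i i w - S.chart i x) ^ (q : ℕ) / ((q : ℕ).factorial : ℂ))) =ᶠ[𝓝 (S.chart i x)]
      fun w => (w - S.chart i x) ^ (q : ℕ) / ((q : ℕ).factorial : ℂ) := by
    filter_upwards [(S.chart i).open_target.mem_nhds ((S.chart i).map_source hi)] with w hw
    rw [factor, coord, S.root_self ((S.chart i).map_target hw), (S.chart i).right_inv hw]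
    simp
  rw [jetMatrix, h.iteratedDeriv_eq, iteratedDeriv_sub_pow_div, Matrix.one_apply]
  simp [Fin.ext_iff]

/-- Every vector is the jet of a polynomial. -/
theorem exists_jet {n : ℕ} (v : Fin n → ℂ) (t₀ : ℂ) : ∃ h : ℂ → ℂ, AnalyticAt ℂ h t₀ ∧
    (fun q : Fin n => iteratedDeriv q h t₀) = v := by
  have ha : ∀ q : Fin n, AnalyticAt ℂ
      (fun t => v q * ((t - t₀) ^ (q : ℕ) / ((q : ℕ).factorial : ℂ))) t₀ := fun q =>
    analyticAt_const.mul ((analyticAt_id.sub analyticAt_const).pow _).div_const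
  refine ⟨fun t => ∑ q : Fin n, v q * ((t - t₀) ^ (q : ℕ) / ((q : ℕ).factorial : ℂ)),
    Finset.analyticAt_fun_sum _ fun q _ => ha q, ?_⟩
  ext k
  rw [iteratedDeriv_fun_sum fun q _ => (ha q).contDiffAt]
  simp only [iteratedDeriv_const_mul_field, iteratedDeriv_sub_pow_div]
  simp [← Fin.ext_iff]

theorem jetMatrix_comp {n : ℕ} (m : ℤ) {i j k : ι} {x : C} (hi : x ∈ S.dom i) (hj : x ∈ S.dom j)
    (hk : x ∈ S.dom k) (v : Fin n → ℂ) :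
    S.jetMatrix n m j k x *ᵥ (S.jetMatrix n m i j x *ᵥ v) = S.jetMatrix n m i k x *ᵥ v := by
  obtain ⟨h, hh, rfl⟩ := exists_jet v (S.chart i x)
  have hc := S.coord_chart (i := i) hj
  have hh' : AnalyticAt ℂ (fun w => S.factor m j i w * h (S.coord j i w)) (S.chart j x) :=
    (S.analyticAt_factor m hi hj).mul
      (AnalyticAt.comp (by rwa [hc]) (S.analyticAt_coord hi hj))
  rw [S.jetMatrix_mulVec m hi hj hh, S.jetMatrix_mulVec m hj hk hh', S.jetMatrix_mulVec m hi hk hh]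
  ext r
  refine Filter.EventuallyEq.iteratedDeriv_eq _ ?_
  have hcont := (S.chart k).continuousAt_symm ((S.chart k).map_source hk)
  have hmem : ∀ᶠ w in 𝓝 (S.chart k x), (S.chart k).symm w ∈ S.dom i ∩ S.dom j ∩ S.dom k := by
    refine hcont.eventually (IsOpen.mem_nhds (((S.chart i).open_source.inter
      (S.chart j).open_source).inter (S.chart k).open_source) ?_)
    rw [(S.chart k).left_inv hk]
    exact ⟨⟨hi, hj⟩, hk⟩
  filter_upwards [hmem] with w hw
  simp only [factor, coord, (S.chart j).left_inv hw.1.2]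
  rw [← S.root_mul k j i _ ⟨⟨hw.2, hw.1.2⟩, hw.1.1⟩, mul_zpow, mul_assoc]

theorem contMDiffOn_jetMatrix (n : ℕ) (m : ℤ) (i j : ι) (r q : Fin n) :
    ContMDiffOn 𝓘(ℂ) 𝓘(ℂ) ω (fun x => S.jetMatrix n m i j x r q) (S.dom i ∩ S.dom j) := by
  rintro x ⟨hi, hj⟩
  set D : ℕ → ℂ → ℂ := fun l => iteratedDeriv r (fun w => S.factor m j i w * S.coord j i w ^ l)
    with hD
  have hDa : ∀ l, AnalyticAt ℂ (D l) (S.chart j x) := fun l => by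
    have h := ((S.analyticAt_factor m hi hj).mul ((S.analyticAt_coord hi hj).pow l)).iterated_deriv
      (r : ℕ)
    rw [← iteratedDeriv_eq_iterate] at h
    exact h
  set Φ : ℂ → ℂ := fun w => (∑ l ∈ Finset.range ((q : ℕ) + 1), (-S.coord j i w) ^ ((q : ℕ) - l) *
    ((q : ℕ).choose l : ℂ) * D l w) / ((q : ℕ).factorial : ℂ) with hΦ
  have hΦa : AnalyticAt ℂ Φ (S.chart j x) := by
    refine AnalyticAt.div_const (Finset.analyticAt_fun_sum _ fun l _ => ?_)
    exact (((S.analyticAt_coord hi hj).neg.pow _).mul analyticAt_const).mul (hDa l)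
  have h1 : ContMDiffAt 𝓘(ℂ) 𝓘(ℂ) ω (S.chart j) x :=
    (contMDiffOn_of_mem_maximalAtlas (S.chart_mem j)).contMDiffAt
      ((S.chart j).open_source.mem_nhds hj)
  have h2 : ContMDiffAt 𝓘(ℂ) 𝓘(ℂ) ω (fun y => Φ (S.chart j y)) x :=
    ContMDiffAt.comp x (contMDiffAt_iff_contDiffAt.2 hΦa.contDiffAt) h1
  have key : ∀ y ∈ S.dom i ∩ S.dom j, S.jetMatrix n m i j y r q = Φ (S.chart j y) := by
    rintro y ⟨hi', hj'⟩
    have e : (fun w => S.factor m j i w *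
        ((S.coord j i w - S.chart i y) ^ (q : ℕ) / ((q : ℕ).factorial : ℂ))) =
        fun w => (∑ l ∈ Finset.range ((q : ℕ) + 1), (-S.chart i y) ^ ((q : ℕ) - l) *
          ((q : ℕ).choose l : ℂ) * (S.factor m j i w * S.coord j i w ^ l)) *
          ((q : ℕ).factorial : ℂ)⁻¹ := by
      funext w
      rw [sub_eq_add_neg, add_pow, ← mul_div_assoc, Finset.mul_sum, div_eq_mul_inv]
      congr 1
      exact Finset.sum_congr rfl fun l _ => by ring
    rw [jetMatrix, e, iteratedDeriv_mul_const_field, iteratedDeriv_fun_sum]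
    · simp only [iteratedDeriv_const_mul_field]
      rw [hΦ]
      simp only [S.coord_chart hj', hD, div_eq_mul_inv]
    · intro l _
      exact (analyticAt_const.mul ((S.analyticAt_factor m hi' hj').mul
        ((S.analyticAt_coord hi' hj').pow l))).contDiffAt
  exact h2.contMDiffWithinAt.congr (fun y hy => key y hy) (key x ⟨hi, hj⟩)

theorem contMDiffOn_jetChange (n : ℕ) (m : ℤ) (i j : ι) :
    ContMDiffOn 𝓘(ℂ) 𝓘(ℂ, (Fin n → ℂ) →L[ℂ] (Fin n → ℂ)) ω
      (fun x => LinearMap.toContinuousLinearMap (Matrix.toLin' (S.jetMatrix n m i j x)))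
      (S.dom i ∩ S.dom j) := by
  refine contMDiffOn_endo fun r q => ?_
  simpa using S.contMDiffOn_jetMatrix n m i j r q

/-- The bundle `J^{n-1}(K^{m/2})` of `(n-1)`-jets of holomorphic sections of `K^{m/2}`. In the
coordinate `z i`, the jet at `x` of a section given by `f` is `(f, f', …, f^{(n-1)})` at `z i x`. -/
def jetBundle (n : ℕ) (m : ℤ) : VectorBundleCore ℂ C (Fin n → ℂ) ι where
  baseSet := S.dom
  isOpen_baseSet i := (S.chart i).open_source
  indexAt := S.indexAt
  mem_baseSet_at := S.mem_source
  coordChange i j x := LinearMap.toContinuousLinearMap (Matrix.toLin' (S.jetMatrix n m i j x))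
  coordChange_self i x hx v := by simp [S.jetMatrix_self m hx]
  continuousOn_coordChange i j := (S.contMDiffOn_jetChange n m i j).continuousOn
  coordChange_comp i j k x hx v := by
    simpa using S.jetMatrix_comp m hx.1.1 hx.1.2 hx.2 v

instance (n : ℕ) (m : ℤ) : (S.jetBundle n m).IsContMDiff 𝓘(ℂ) ω where
  contMDiffOn_coordChange i j := S.contMDiffOn_jetChange n m i j

end SpinStructure

/-- A holomorphic isomorphism between two holomorphic vector bundles over a complex manifold: a
family of linear isomorphisms between the fibres which is holomorphic, together with its inverse,
as a map between total spaces. -/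
structure HolomorphicBundleIso {B H M : Type*} [NormedAddCommGroup B] [NormedSpace ℂ B]
    [TopologicalSpace H] (I : ModelWithCorners ℂ B H) [TopologicalSpace M] [ChartedSpace H M]
    (F₁ : Type*) [NormedAddCommGroup F₁] [NormedSpace ℂ F₁] (E₁ : M → Type*)
    [∀ x, AddCommMonoid (E₁ x)] [∀ x, Module ℂ (E₁ x)] [∀ x, TopologicalSpace (E₁ x)]
    [TopologicalSpace (TotalSpace F₁ E₁)] [FiberBundle F₁ E₁]
    (F₂ : Type*) [NormedAddCommGroup F₂] [NormedSpace ℂ F₂] (E₂ : M → Type*)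
    [∀ x, AddCommMonoid (E₂ x)] [∀ x, Module ℂ (E₂ x)] [∀ x, TopologicalSpace (E₂ x)]
    [TopologicalSpace (TotalSpace F₂ E₂)] [FiberBundle F₂ E₂] where
  toEquiv : ∀ x, E₁ x ≃L[ℂ] E₂ x
  holomorphic : ContMDiff (I.prod 𝓘(ℂ, F₁)) (I.prod 𝓘(ℂ, F₂)) ω
    fun v : TotalSpace F₁ E₁ => (⟨v.1, toEquiv v.1 v.2⟩ : TotalSpace F₂ E₂)
  holomorphic_symm : ContMDiff (I.prod 𝓘(ℂ, F₂)) (I.prod 𝓘(ℂ, F₁)) ω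
    fun v : TotalSpace F₂ E₂ => (⟨v.1, (toEquiv v.1).symm v.2⟩ : TotalSpace F₁ E₁)

namespace SpinStructure

variable {C ι : Type*} [TopologicalSpace C] [ChartedSpace ℂ C] (S : SpinStructure C ι)

/-- The rank `n` bundle `E = J^{n-1}(K^{-(n-1)/2})`. -/
abbrev jetE (n : ℕ) : VectorBundleCore ℂ C (Fin n → ℂ) ι := S.jetBundle n (-((n : ℤ) - 1))

/-- The exponent of `K^{1/2}` in the summand `K^{-(n-1)/2+r}` of `gradedE`. -/
abbrev gradedExp (n : ℕ) (r : Fin n) : ℤ := -((n : ℤ) - 1) + 2 * (r : ℕ)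

/-- The rank `n` bundle `⨁_{r=0}^{n-1} K^{-(n-1)/2+r}`. -/
abbrev gradedE (n : ℕ) : VectorBundleCore ℂ C (Fin n → ℂ) ι := S.canonicalSum (gradedExp n)

/-- The step `F^r` of the filtration of `E = J^{n-1}(L)`, `L = K^{-(n-1)/2}`: the kernel of the
projection to `J^{n-1-r}(L)`, i.e. the jets all of whose derivatives of order `< n - r` vanish. -/
def filtration (n r : ℕ) (p : C) : Submodule ℂ ((S.jetE n).Fiber p) := oppSub n (n - r)

/-- The leading coefficient of a jet in `F^{n-k}`, i.e. its `k`-th derivative, as an element of the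
line bundle `K^{-(n-1)/2+k}`. -/
def symbol (n : ℕ) (k : Fin n) (p : C) :
    S.filtration n (n - k) p →ₗ[ℂ] (S.canonicalPow (gradedExp n k)).Fiber p :=
  (LinearMap.proj k : (Fin n → ℂ) →ₗ[ℂ] ℂ) ∘ₗ
    (oppSub n (n - (n - k))).subtype

/-- The projection of `⨁_r K^{-(n-1)/2+r}` to its `k`-th summand. -/
def component (n : ℕ) (k : Fin n) (p : C) :
    (S.gradedE n).Fiber p →ₗ[ℂ] (S.canonicalPow (gradedExp n k)).Fiber p :=
  (LinearMap.proj k : (Fin n → ℂ) →ₗ[ℂ] ℂ)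

/-- The sum of the first `j` summands of `⨁_r K^{-(n-1)/2+r}`. -/
def partialSum (n j : ℕ) (p : C) : Submodule ℂ ((S.gradedE n).Fiber p) := stdSub n j

variable [IsManifold 𝓘(ℂ) ω C]

/-- The total space `X = Fl(E)` of the relative flag manifold of `E`. -/
abbrev Fl (n : ℕ) : Type _ := FlagBundle n (S.jetE n).Fiber

/-- The flags `W` in `E p` with `dim (W^j ∩ F^{n+i-j}) = i` for `0 ≤ i ≤ j ≤ n`. -/
def bigCellSet (n : ℕ) : Set (S.Fl n) :=
  {x | ∀ (j : Fin (n + 1)) (i : ℕ), i ≤ (j : ℕ) →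
    Module.finrank ℂ ↥(x.flag.space j ⊓ S.filtration n (n + i - j) x.base) = i}

theorem mem_bigCellSet_iff {n : ℕ} {x : S.Fl n} : x ∈ S.bigCellSet n ↔
    ∀ j : Fin (n + 1), x.flag.space j ⊓ S.filtration n (n - j) x.base = ⊥ := by
  have : FiniteDimensional ℂ ((S.jetE n).Fiber x.base) :=
    inferInstanceAs (FiniteDimensional ℂ (Fin n → ℂ))
  have hdim : Module.finrank ℂ ((S.jetE n).Fiber x.base) = n :=
    (Module.finrank_fintype_fun_eq_card ℂ).trans (Fintype.card_fin n)
  have hF : ∀ r ≤ n, Module.finrank ℂ (S.filtration n r x.base) = r := fun r hr => by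
    have := finrank_oppSub (n := n) (j := n - r) (Nat.sub_le _ _)
    rw [show n - (n - r) = r by omega] at this
    exact this
  constructor
  · intro h j
    have := h j 0 (Nat.zero_le _)
    rw [add_zero] at this
    exact Submodule.finrank_eq_zero.1 this
  · intro h j i hij
    have hj : (j : ℕ) ≤ n := Nat.lt_succ_iff.1 j.2
    have hle : S.filtration n (n - j) x.base ≤ S.filtration n (n + i - j) x.base :=
      fun v hv r hr => hv r (by omega)
    have h1 := Submodule.finrank_sup_add_finrank_inf_eq (x.flag.space j)
      (S.filtration n (n + i - j) x.base)
    rw [x.flag.finrank_space, hF _ (by omega)] at h1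
    have h2 : Module.finrank ℂ ↥(x.flag.space j ⊔ S.filtration n (n + i - j) x.base) ≤ n :=
      (Submodule.finrank_le _).trans hdim.le
    have h3 := Submodule.finrank_sup_add_finrank_inf_eq
      (x.flag.space j ⊓ S.filtration n (n + i - j) x.base) (S.filtration n (n - j) x.base)
    have h4 : x.flag.space j ⊓ S.filtration n (n + i - j) x.base ⊓
        S.filtration n (n - j) x.base = ⊥ := by
      rw [inf_assoc, inf_eq_right.2 hle, h j]
    have h5 := Submodule.finrank_mono (sup_le (inf_le_right :
      x.flag.space j ⊓ S.filtration n (n + i - j) x.base ≤ _) hle)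
    rw [h4, finrank_bot, hF (n - j) (by omega)] at h3
    rw [hF _ (by omega)] at h5
    omega

theorem linearMapAt_localTriv {n : ℕ} {i : ι} {p : C} (hp : p ∈ S.dom i)
    (v : (S.jetE n).Fiber p) : ((S.jetE n).localTriv i).linearMapAt ℂ p v =
      S.jetMatrix n (-((n : ℤ) - 1)) (S.indexAt p) i p *ᵥ v := by
  rw [Trivialization.coe_linearMapAt_of_mem _ hp]
  rfl

theorem linearMapAt_mem_oppSub {n : ℕ} {i : ι} {p : C} (hp : p ∈ S.dom i) (j : ℕ)
    (v : Fin n → ℂ) (hv : v ∈ oppSub n j) :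
    ((S.jetE n).localTriv i).linearMapAt ℂ p (v : (S.jetE n).Fiber p) ∈ oppSub n j := by
  refine (congrArg (· ∈ oppSub n j) (S.linearMapAt_localTriv hp v)).mpr ?_
  intro r hr
  change ∑ q, S.jetMatrix n (-((n : ℤ) - 1)) (S.indexAt p) i p r q * v q = 0
  refine Finset.sum_eq_zero fun q _ => ?_
  by_cases hq : (q : ℕ) < j
  · rw [hv q hq, mul_zero]
  · rw [S.jetMatrix_upper _ (S.mem_source p) hp (by rw [Fin.lt_def]; omega), zero_mul]

theorem mem_bigCellSet_iff_trivFlag {n : ℕ} {i : ι} {x : S.Fl n} (hx : x.base ∈ S.dom i) :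
    x ∈ S.bigCellSet n ↔ ∀ j : Fin (n + 1),
      FlagBundle.trivFlag ((S.jetE n).localTriv i) x j ⊓ oppSub n j = ⊥ := by
  have hinj : Function.Injective (((S.jetE n).localTriv i).linearMapAt ℂ x.base) := by
    rw [Trivialization.linearMapAt_def_of_mem _ hx]
    exact (((S.jetE n).localTriv i).linearEquivAt ℂ x.base hx).injective
  rw [mem_bigCellSet_iff]
  refine forall_congr' fun j => ?_
  have hj : (j : ℕ) ≤ n := Nat.lt_succ_iff.1 j.2
  have hfil : (S.filtration n (n - j) x.base).map
      (((S.jetE n).localTriv i).linearMapAt ℂ x.base) = oppSub n j := by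
    refine Submodule.eq_of_le_of_finrank_eq ?_ ?_
    · rintro _ ⟨v, hv, rfl⟩
      refine S.linearMapAt_mem_oppSub hx j v fun r hr => hv r (by omega)
    · refine (Submodule.equivMapOfInjective _ hinj _).finrank_eq.symm.trans ?_
      have : S.filtration n (n - j) x.base = oppSub n j := by
        rw [filtration, show n - (n - (j : ℕ)) = j by omega]
      rw [this]
      rfl
  rw [← hfil, FlagBundle.trivFlag, ← Submodule.map_inf _ hinj]
  refine ⟨fun h => by rw [h, Submodule.map_bot], fun h => ?_⟩
  exact Submodule.map_injective_of_injective hinj (by rw [h, Submodule.map_bot])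

theorem isOpen_bigCellSet (n : ℕ) : IsOpen (S.bigCellSet n) := by
  rw [isOpen_iff_mem_nhds]
  intro x hx
  have hsrc := (chartAt (ℂ × (LowerIdx n → ℂ)) x).open_source.mem_nhds (mem_chart_source _ x)
  have hflag : ∀ y ∈ (chartAt (ℂ × (LowerIdx n → ℂ)) x).source, y ∈ S.bigCellSet n ↔
      IsBig (x.frame * lowerUni (chartAt (ℂ × (LowerIdx n → ℂ)) x y).2) := by
    rintro y ⟨⟨h1, h2⟩, u, hu⟩
    have hy : (chartAt (ℂ × (LowerIdx n → ℂ)) x y).2 = u := FlagBundle.chart_snd hu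
    rw [hy, S.mem_bigCellSet_iff_trivFlag (i := S.indexAt x.base) h2]
    refine forall_congr' fun j => ?_
    rw [det_mix_ne_zero_iff (x.det_frame_mul u), ← hu]
    rfl
  have hA : ∀ r c, ContDiffAt ℂ ω (fun a : ℂ × (LowerIdx n → ℂ) =>
      (x.frame * lowerUni a.2) r c) (chartAt (ℂ × (LowerIdx n → ℂ)) x x) := by
    intro r c
    simp only [Matrix.mul_apply]
    exact ContDiffAt.sum fun k _ => contDiffAt_const.mul (contDiffAt_lowerUni _ k c)
  have hev := ((chartAt (ℂ × (LowerIdx n → ℂ)) x).continuousAt (mem_chart_source _ x)).eventually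
    (eventually_isBig hA ((hflag x (mem_chart_source _ x)).1 hx))
  filter_upwards [hsrc, hev] with y h1 h2
  exact (hflag y h1).2 h2

/-- The big cell `X₀`, as an open submanifold of `X`. -/
def bigCell (n : ℕ) : TopologicalSpace.Opens (S.Fl n) := ⟨S.bigCellSet n, S.isOpen_bigCellSet n⟩

/-- The projection `π : X₀ → C`. -/
def bigCellProj (n : ℕ) :
    C^ω⟮𝓘(ℂ, ℂ × (LowerIdx n → ℂ)), S.bigCell n; 𝓘(ℂ), C⟯ :=
  ⟨fun x => x.1.base, FlagBundle.contMDiff_base.comp contMDiff_subtype_val⟩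

end SpinStructure

end

/-! Over a trivializing open set `U i` of `E`, a point of the big cell is a flag in `ℂⁿ` in general
position with respect to the filtration by vanishing initial coordinates. By Gauss factorization
(`exists_lowerUni_frame`) such a flag is spanned by the columns of a lower unipotent matrix `N i`,
which is unique and depends holomorphically on the flag (`contMDiffAt_lowerCoord`).

The matrices `N i` are glued by comparing transition functions. The change of jet coordinates `J`
from `U i` to `U j` is lower triangular, and its diagonal entries are the transition functions of
the line bundles `K^{-(n-1)/2+r}` (`jetMatrix_diag`): the leading derivative of a section transforms
by the tensor rule. With `D` the diagonal part of `J`, the matrix `J * N i * D⁻¹` is again lower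
unipotent and its columns span the same flag in the coordinates over `U j`, so it is `N j` by
uniqueness. The identity `J * N i = N j * D` (`jetMatrix_mul_lowerUni`) says that the maps
`(N i)⁻¹` define a global isomorphism from the pullback of `E` to the pullback of the graded bundle.

It carries the span `W^j` of the first `j` columns to the span of the first `j` basis vectors. Being
unipotent and lower triangular, it preserves the filtration and is the identity on its graded
pieces, where the identity is the leading coefficient map. -/

/-! ### Lower unipotent matrices -/

theorem lowerUni_of_isLowerUnipotent {n : ℕ} {M : Matrix (Fin n) (Fin n) ℂ}
    (hdiag : ∀ r, M r r = 1) (hupper : ∀ r c, r < c → M r c = 0) :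
    lowerUni (fun p : LowerIdx n => M p.1.1 p.1.2) = M := by
  ext r c
  rcases lt_trichotomy r c with h | rfl | h
  · rw [lowerUni_upper _ h, hupper r c h]
  · rw [lowerUni_diag, hdiag]
  · exact lowerUni_lower _ ⟨(r, c), h⟩

theorem isUnit_det_lowerUni {n : ℕ} (u : LowerIdx n → ℂ) : IsUnit (lowerUni u).det := by
  simp [det_lowerUni]

theorem lowerUni_mulVec_of_forall_lt {n : ℕ} (u : LowerIdx n → ℂ) {w : Fin n → ℂ} {k : Fin n}
    (hw : ∀ r < k, w r = 0) : (lowerUni u *ᵥ w) k = w k := by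
  rw [Matrix.mulVec, dotProduct, Finset.sum_eq_single k, lowerUni_diag, one_mul]
  · intro r _ hr
    rcases lt_or_gt_of_ne hr with h | h
    · rw [hw r h, mul_zero]
    · rw [lowerUni_upper u h, zero_mul]
  · simp

theorem eq_zero_of_lowerUni_mulVec {n : ℕ} (u : LowerIdx n → ℂ) {w : Fin n → ℂ} {k : Fin n}
    (h : ∀ r < k, (lowerUni u *ᵥ w) r = 0) : ∀ r < k, w r = 0 := by
  intro r
  induction r using WellFoundedLT.induction with
  | ind r ih =>
    intro hr
    rw [← lowerUni_mulVec_of_forall_lt u fun s hs => ih s hs (hs.trans hr), h r hr]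

theorem mulVec_diagonal_mem_stdSub {n j : ℕ} (d : Fin n → ℂ) {v : Fin n → ℂ}
    (hv : v ∈ stdSub n j) : diagonal d *ᵥ v ∈ stdSub n j := fun r hr => by
  rw [mulVec_diagonal, hv r hr, mul_zero]

/-- Rescaling the columns of a matrix does not change the flag they span. -/
theorem colSpan_mul_diagonal {n : ℕ} (M : Matrix (Fin n) (Fin n) ℂ) {d : Fin n → ℂ}
    (hd : ∀ r, d r ≠ 0) (j : ℕ) : colSpan (M * diagonal d) j = colSpan M j := by
  refine le_antisymm ?_ ?_ <;> intro v hv <;> obtain ⟨x, hx, rfl⟩ := mem_colSpan.1 hv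
  · exact mem_colSpan.2 ⟨_, mulVec_diagonal_mem_stdSub d hx, by rw [mulVec_mulVec]⟩
  · refine mem_colSpan.2 ⟨_, mulVec_diagonal_mem_stdSub (fun r => (d r)⁻¹) hx, ?_⟩
    rw [mulVec_mulVec, Matrix.mul_assoc, diagonal_mul_diagonal]
    simp [hd]

/-- Uniqueness of the lower unipotent frame of a flag, in the form needed to compare
trivializations: a lower triangular change of coordinates `J` carries the lower unipotent frame
of a flag to the lower unipotent frame of its image, up to the diagonal part of `J`. -/
theorem mul_lowerUni_eq_lowerUni_mul_diagonal {n : ℕ} {J : Matrix (Fin n) (Fin n) ℂ}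
    (hdiag : ∀ r, J r r ≠ 0) (hupper : ∀ r c, r < c → J r c = 0) {u u' : LowerIdx n → ℂ}
    (h : ∀ j : Fin (n + 1), colSpan (lowerUni u') j = (colSpan (lowerUni u) j).map J.toLin') :
    J * lowerUni u = lowerUni u' * diagonal fun r => J r r := by
  -- Normalizing the diagonal of `J * lowerUni u` gives a lower unipotent frame of the image flag.
  set M := J * lowerUni u * diagonal (fun r => (J r r)⁻¹) with hM
  have hlow : ∀ r c, r < c → (J * lowerUni u) r c = 0 := fun r c hrc => by
    rw [Matrix.mul_apply]
    refine Finset.sum_eq_zero fun k _ => ?_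
    rcases lt_or_ge r k with hk | hk
    · rw [hupper r k hk, zero_mul]
    · rw [lowerUni_upper u (hk.trans_lt hrc), mul_zero]
  have hd : ∀ r, (J * lowerUni u) r r = J r r := fun r => by
    rw [Matrix.mul_apply, Finset.sum_eq_single r, lowerUni_diag, mul_one]
    · intro k _ hk
      rcases lt_or_gt_of_ne hk with hk | hk
      · rw [lowerUni_upper u hk, mul_zero]
      · rw [hupper r k hk, zero_mul]
    · simp
  have hMu := lowerUni_of_isLowerUnipotent (M := M)
    (fun r => by rw [hM, mul_diagonal, hd, mul_inv_cancel₀ (hdiag r)])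
    (fun r c hrc => by rw [hM, mul_diagonal, hlow r c hrc, zero_mul])
  have hu : (fun p : LowerIdx n => M p.1.1 p.1.2) = u' := lowerUni_inj fun j => by
    rw [hMu, hM, colSpan_mul_diagonal _ (fun r => inv_ne_zero (hdiag r)), colSpan_mul, h]
  rw [← hu, hMu, hM, Matrix.mul_assoc, diagonal_mul_diagonal]
  simp [hdiag]

theorem ContMDiffAt.matrix_mulVec {n : ℕ} {B H X : Type*} [NormedAddCommGroup B]
    [NormedSpace ℂ B] [TopologicalSpace H] {I : ModelWithCorners ℂ B H} [TopologicalSpace X]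
    [ChartedSpace H X] {A : X → Matrix (Fin n) (Fin n) ℂ} {f : X → Fin n → ℂ} {x : X}
    (hA : ∀ r c, ContMDiffAt I 𝓘(ℂ) ω (fun y => A y r c) x)
    (hf : ContMDiffAt I 𝓘(ℂ, Fin n → ℂ) ω f x) :
    ContMDiffAt I 𝓘(ℂ, Fin n → ℂ) ω (fun y => A y *ᵥ f y) x := by
  refine contMDiffAt_pi_space.2 fun r => ?_
  simp only [mulVec, dotProduct]
  exact contMDiffAt_finsetSum fun c _ => (hA r c).mul (contMDiffAt_pi_space.1 hf c)

/-! ### The diagonal of the jet transition matrices -/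

/-- In the Leibniz formula only the term with all derivatives on `(w - w₀)^r` survives. -/
theorem iteratedDeriv_mul_sub_pow_div (r : ℕ) {g : ℂ → ℂ} {w₀ : ℂ} (hg : AnalyticAt ℂ g w₀) :
    iteratedDeriv r (fun w => g w * ((w - w₀) ^ r / (r.factorial : ℂ))) w₀ = g w₀ := by
  have hP : AnalyticAt ℂ (fun w : ℂ => (w - w₀) ^ r / (r.factorial : ℂ)) w₀ :=
    ((analyticAt_id.sub analyticAt_const).pow _).div_const
  rw [iteratedDeriv_fun_mul hg.contDiffAt hP.contDiffAt, Finset.sum_eq_single 0]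
  · rw [iteratedDeriv_sub_pow_div]
    simp
  · intro k hk hk0
    rw [iteratedDeriv_sub_pow_div, if_neg (by grind), mul_zero]
  · simp

/-- To leading order, `(τ - τ w₀)^r / r!` is `(τ' w₀)^r (w - w₀)^r / r!`. -/
theorem iteratedDeriv_mul_comp_sub_pow_div (r : ℕ) {g τ : ℂ → ℂ} {w₀ : ℂ}
    (hg : AnalyticAt ℂ g w₀) (hτ : AnalyticAt ℂ τ w₀) :
    iteratedDeriv r (fun w => g w * ((τ w - τ w₀) ^ r / (r.factorial : ℂ))) w₀ =
      g w₀ * deriv τ w₀ ^ r := by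
  -- Write `τ w - τ w₀ = (w - w₀) * s w`, so that `s w₀` is the derivative of `τ` at `w₀`.
  obtain ⟨s, hs, hs'⟩ := (natCast_le_analyticOrderAt
    (f := fun w => τ w - τ w₀) (hτ.sub analyticAt_const) (n := 1)).1
    ((natCast_le_analyticOrderAt_iff_iteratedDeriv_eq_zero
      (f := fun w => τ w - τ w₀) (hτ.sub analyticAt_const)).2 fun k hk => by
        obtain rfl : k = 0 := by omega
        simp)
  simp only [pow_one, smul_eq_mul] at hs'
  have hderiv : deriv τ w₀ = s w₀ := by
    have h1 : τ =ᶠ[𝓝 w₀] fun w => (w - w₀) * s w + τ w₀ := by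
      filter_upwards [hs'] with w hw
      rw [← hw, sub_add_cancel]
    have h2 : HasDerivAt (fun w => (w - w₀) * s w + τ w₀) (1 * s w₀ + (w₀ - w₀) * deriv s w₀) w₀ :=
      (((hasDerivAt_id w₀).sub_const w₀).mul hs.differentiableAt.hasDerivAt).add_const _
    rw [h1.deriv_eq, h2.deriv]
    ring
  have h3 : (fun w => g w * ((τ w - τ w₀) ^ r / (r.factorial : ℂ))) =ᶠ[𝓝 w₀]
      fun w => (g w * s w ^ r) * ((w - w₀) ^ r / (r.factorial : ℂ)) := by
    filter_upwards [hs'] with w hw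
    rw [hw, mul_pow]
    ring
  rw [h3.iteratedDeriv_eq, hderiv]
  exact iteratedDeriv_mul_sub_pow_div r (hg.mul (hs.pow r))

namespace SpinStructure

variable {C ι : Type*} [TopologicalSpace C] [ChartedSpace ℂ C] (S : SpinStructure C ι)

/-- The leading coefficient of an `r`-th order jet of `K^{m/2}` transforms like `K^{m/2+r}`. -/
theorem jetMatrix_diag {n : ℕ} (m : ℤ) {i j : ι} {x : C} (hi : x ∈ S.dom i) (hj : x ∈ S.dom j)
    (r : Fin n) : S.jetMatrix n m i j x r r = S.root j i x ^ (m + 2 * (r : ℕ)) := by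
  have hc := S.coord_chart (i := i) hj
  have h := iteratedDeriv_mul_comp_sub_pow_div r (S.analyticAt_factor m hi hj)
    (S.analyticAt_coord hi hj)
  rw [hc] at h
  rw [jetMatrix, h, zpow_add₀ (S.root_ne_zero hj hi), factor, (S.chart j).left_inv hj,
    _root_.zpow_mul]
  congr 1
  rw [show S.root j i x ^ (2 : ℤ) = S.root j i x ^ 2 from zpow_natCast _ 2,
    S.root_sq j i x ⟨hj, hi⟩, zpow_natCast]
  rfl

/-- The transition matrix of the graded bundle is the diagonal part of that of `E`. -/
theorem linearMapAt_gradedE {n : ℕ} {i : ι} {p : C} (hp : p ∈ S.dom i)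
    (v : (S.gradedE n).Fiber p) : ((S.gradedE n).localTriv i).linearMapAt ℂ p v =
      diagonal (fun r => S.jetMatrix n (-((n : ℤ) - 1)) (S.indexAt p) i p r r) *ᵥ v := by
  rw [Trivialization.coe_linearMapAt_of_mem _ hp]
  refine funext fun r => Eq.trans ?_ (mulVec_diagonal _ _ r).symm
  rw [S.jetMatrix_diag _ (S.mem_source p) hp]
  rfl

theorem linearMapAt_canonicalPow {m : ℤ} {i : ι} {p : C} (hp : p ∈ S.dom i)
    (v : ℂ) : ((S.canonicalPow m).localTriv i).linearMapAt ℂ p (v : (S.canonicalPow m).Fiber p) =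
      S.root i (S.indexAt p) p ^ m * v := by
  rw [Trivialization.coe_linearMapAt_of_mem _ hp]
  rfl

theorem mem_filtration {n : ℕ} (k : Fin n) {p : C} {v : Fin n → ℂ} :
    v ∈ S.filtration n (n - k) p ↔ ∀ r < k, v r = 0 := by
  change (∀ r : Fin n, (r : ℕ) < n - (n - k) → v r = 0) ↔ _
  rw [show n - (n - (k : ℕ)) = k by omega]
  rfl

theorem mem_filtration_sub_one {n : ℕ} (k : Fin n) {p : C} {v : Fin n → ℂ} :
    v ∈ S.filtration n (n - k - 1) p ↔ ∀ r ≤ k, v r = 0 := by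
  change (∀ r : Fin n, (r : ℕ) < n - (n - k - 1) → v r = 0) ↔ _
  rw [show n - (n - (k : ℕ) - 1) = k + 1 by omega]
  exact forall_congr' fun r => imp_congr_left Nat.lt_succ_iff

theorem symbol_surjective (n : ℕ) (k : Fin n) (p : C) :
    Function.Surjective (S.symbol n k p) := fun c =>
  ⟨⟨(Pi.single k (c : ℂ) : Fin n → ℂ), (S.mem_filtration k).2 fun _ hr =>
      Pi.single_eq_of_ne (M := fun _ : Fin n => ℂ) hr.ne c⟩,
    Pi.single_eq_same (M := fun _ : Fin n => ℂ) k c⟩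

theorem ker_symbol (n : ℕ) (k : Fin n) (p : C) : LinearMap.ker (S.symbol n k p) =
    (S.filtration n (n - k - 1) p).comap (S.filtration n (n - k) p).subtype := by
  ext ⟨v, hv⟩
  have hv' := (S.mem_filtration k).1 hv
  refine Iff.trans ?_ (S.mem_filtration_sub_one (p := p) (v := v) k).symm
  change (v : Fin n → ℂ) k = 0 ↔ _
  refine ⟨fun h r hr => ?_, fun h => h k le_rfl⟩
  rcases hr.eq_or_lt with rfl | hr
  exacts [h, hv' r hr]

/-- On jets whose derivatives of order `< k` vanish, only the diagonal entry of the jet transition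
matrix contributes to the `k`-th derivative. -/
theorem linearMapAt_symbol [IsManifold 𝓘(ℂ) ω C] {n : ℕ} (k : Fin n) {p : C} {i : ι}
    (hp : p ∈ S.dom i) (v : S.filtration n (n - k) p) : ((S.jetE n).localTriv i).linearMapAt ℂ p v k =
      ((S.canonicalPow (gradedExp n k)).localTriv i).linearMapAt ℂ p (S.symbol n k p v) := by
  have hv := (S.mem_filtration k).1 v.2
  refine (congrFun (S.linearMapAt_localTriv hp v.1) k).trans
    (Eq.trans ?_ (S.linearMapAt_canonicalPow hp (v.1 k)).symm)
  rw [← S.jetMatrix_diag _ (S.mem_source p) hp]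
  refine Finset.sum_eq_single k (fun r _ hr => ?_)
    fun h => absurd (Finset.mem_univ k) h
  change _ * (v.1 : Fin n → ℂ) r = 0
  rcases lt_or_gt_of_ne hr with h | h
  · rw [hv r h, mul_zero]
  · exact (congrArg (· * (v.1 : Fin n → ℂ) r)
      (S.jetMatrix_upper _ (S.mem_source p) hp h)).trans (zero_mul _)

end SpinStructure

/-! ### The lower unipotent frame of a flag in the big cell -/

namespace SpinStructure

variable {C ι : Type*} [TopologicalSpace C] [ChartedSpace ℂ C] [IsManifold 𝓘(ℂ) ω C]
  (S : SpinStructure C ι)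

/-- Gauss factorization: a flag in the big cell has a lower unipotent frame in every
trivialization. -/
theorem exists_lowerUni_frame {n : ℕ} {i : ι} {x : S.Fl n} (hx : x ∈ S.bigCellSet n)
    (hi : x.base ∈ S.dom i) : ∃ u : LowerIdx n → ℂ, ∀ j : Fin (n + 1),
      FlagBundle.trivFlag ((S.jetE n).localTriv i) x j = colSpan (lowerUni u) j := by
  obtain ⟨M, hM, h⟩ := (x.flag.map (((S.jetE n).localTriv i).linearEquivAt ℂ x.base
    hi)).exists_frame
  have h' : ∀ j, FlagBundle.trivFlag ((S.jetE n).localTriv i) x j = colSpan M j := fun j => by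
    rw [← h, FlagBundle.trivFlag, Trivialization.linearMapAt_def_of_mem _ hi]
    rfl
  have hbig : IsBig M := fun j => by
    rw [det_mix_ne_zero_iff hM, ← h']
    exact (S.mem_bigCellSet_iff_trivFlag hi).1 hx j
  exact ⟨lowerPart M, fun j => by rw [h', colSpan_lowerPart hbig]⟩

open Classical in
/-- The entries below the diagonal of the lower unipotent matrix `N` whose columns span the flag
`x` in the trivialization of `E` over `U i`; zero if there is no such matrix. -/
noncomputable def lowerCoord {n : ℕ} (i : ι) (x : S.Fl n) : LowerIdx n → ℂ :=
  if h : ∃ u : LowerIdx n → ℂ, ∀ j : Fin (n + 1),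
    FlagBundle.trivFlag ((S.jetE n).localTriv i) x j = colSpan (lowerUni u) j
  then h.choose else 0

theorem trivFlag_eq_colSpan_lowerCoord {n : ℕ} {i : ι} {x : S.Fl n} (hx : x ∈ S.bigCellSet n)
    (hi : x.base ∈ S.dom i) (j : Fin (n + 1)) :
    FlagBundle.trivFlag ((S.jetE n).localTriv i) x j = colSpan (lowerUni (S.lowerCoord i x)) j := by
  have h := S.exists_lowerUni_frame hx hi
  rw [lowerCoord, dif_pos h]
  exact h.choose_spec j

/-- In the chart of `Fl(E)` around `x₀`, the lower unipotent frame is obtained from the chart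
coordinates by Gauss factorization, hence is holomorphic. -/
theorem contMDiffAt_lowerCoord {n : ℕ} {x₀ : S.Fl n} (hx₀ : x₀ ∈ S.bigCellSet n) :
    ContMDiffAt 𝓘(ℂ, ℂ × (LowerIdx n → ℂ)) 𝓘(ℂ, LowerIdx n → ℂ) ω
      (S.lowerCoord (S.indexAt x₀.base)) x₀ := by
  set c := chartAt (ℂ × (LowerIdx n → ℂ)) x₀ with hc
  have key : ∀ y ∈ c.source, y ∈ S.bigCellSet n →
      IsBig (x₀.frame * lowerUni (c y).2) ∧
      S.lowerCoord (S.indexAt x₀.base) y = lowerPart (x₀.frame * lowerUni (c y).2) := by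
    rintro y ⟨⟨h1, h2⟩, u, hu⟩ hy
    have hcu : (c y).2 = u := FlagBundle.chart_snd hu
    have hN := S.trivFlag_eq_colSpan_lowerCoord hy (i := S.indexAt x₀.base) h2
    have hcol : ∀ j : Fin (n + 1), colSpan (x₀.frame * lowerUni u) j =
        colSpan (lowerUni (S.lowerCoord (S.indexAt x₀.base) y)) j := fun j =>
      (hu j).symm.trans (hN j)
    have hbig := isBig_of_colSpan_eq (x₀.det_frame_mul u) hcol
    rw [hcu]
    exact ⟨hbig, lowerUni_inj fun j => by rw [colSpan_lowerPart hbig, hcol]⟩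
  have hA : ∀ r s, ContDiffAt ℂ ω (fun a : ℂ × (LowerIdx n → ℂ) =>
      (x₀.frame * lowerUni a.2) r s) (c x₀) := fun r s => by
    simp only [Matrix.mul_apply]
    exact ContDiffAt.sum fun k _ => contDiffAt_const.mul (contDiffAt_lowerUni _ k s)
  have h1 : ContMDiffAt 𝓘(ℂ, ℂ × (LowerIdx n → ℂ)) 𝓘(ℂ, ℂ × (LowerIdx n → ℂ)) ω c x₀ :=
    contMDiffOn_chart.contMDiffAt (c.open_source.mem_nhds (mem_chart_source _ x₀))
  have h2 := contMDiffAt_iff_contDiffAt.2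
    (contDiffAt_lowerPart hA (key x₀ (mem_chart_source _ x₀) hx₀).1)
  refine (h2.comp x₀ h1).congr_of_eventuallyEq ?_
  filter_upwards [c.open_source.mem_nhds (mem_chart_source _ x₀),
    (S.isOpen_bigCellSet n).mem_nhds hx₀] with y hy hy'
  exact (key y hy hy').2

/-- The lower unipotent frames of a flag in two trivializations differ by the transition matrix of
`E` on the left and that of the graded bundle on the right. -/
theorem jetMatrix_mul_lowerUni {n : ℕ} {i : ι} {x : S.Fl n} (hx : x ∈ S.bigCellSet n)
    (hi : x.base ∈ S.dom i) :
    S.jetMatrix n (-((n : ℤ) - 1)) (S.indexAt x.base) i x.base *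
        lowerUni (S.lowerCoord (S.indexAt x.base) x) =
      lowerUni (S.lowerCoord i x) *
        diagonal fun r => S.jetMatrix n (-((n : ℤ) - 1)) (S.indexAt x.base) i x.base r r := by
  have h0 := S.mem_source x.base
  refine mul_lowerUni_eq_lowerUni_mul_diagonal (fun r => ?_)
    (fun r c h => S.jetMatrix_upper _ h0 hi h) fun j => ?_
  · rw [S.jetMatrix_diag _ h0 hi]
    exact zpow_ne_zero _ (S.root_ne_zero hi h0)
  · rw [← S.trivFlag_eq_colSpan_lowerCoord hx hi, ← S.trivFlag_eq_colSpan_lowerCoord hx h0,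
      FlagBundle.trivFlag_change ((S.jetE n).localTriv (S.indexAt x.base))
        ((S.jetE n).localTriv i) x h0 hi]
    congr 1
    refine LinearMap.ext fun v => ?_
    exact (S.jetE n).localTriv_coordChange_eq _ _ ⟨h0, hi⟩ v

theorem linearMapAt_localTriv_indexAt {n : ℕ} {p : C} (v : (S.jetE n).Fiber p) :
    ((S.jetE n).localTriv (S.indexAt p)).linearMapAt ℂ p v = v := by
  rw [S.linearMapAt_localTriv (S.mem_source p), S.jetMatrix_self _ (S.mem_source p)]
  exact one_mulVec _

/-- The fibre of `E` at `p` is `ℂⁿ` by way of the preferred trivialization, so there the flag itself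
is spanned by the columns of its lower unipotent frame. -/
theorem mem_flag_iff {n : ℕ} {x : S.Fl n} (hx : x ∈ S.bigCellSet n) (j : Fin (n + 1))
    (v : (S.jetE n).Fiber x.base) : v ∈ x.flag.space j ↔
      (v : Fin n → ℂ) ∈ colSpan (lowerUni (S.lowerCoord (S.indexAt x.base) x)) j := by
  rw [← S.trivFlag_eq_colSpan_lowerCoord hx (S.mem_source x.base), FlagBundle.trivFlag]
  constructor
  · exact fun h => ⟨v, h, S.linearMapAt_localTriv_indexAt v⟩
  · rintro ⟨w, hw, e⟩
    have : w = v := (S.linearMapAt_localTriv_indexAt w).symm.trans e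
    exact this ▸ hw

/-! ### The splitting of the pulled back jet bundle -/

/-- The linear automorphism `v ↦ N⁻¹ v` of `ℂⁿ`, where `N = lowerUni u`. -/
noncomputable def lowerUniEquiv {n : ℕ} (u : LowerIdx n → ℂ) : (Fin n → ℂ) ≃L[ℂ] (Fin n → ℂ) :=
  (LinearEquiv.ofLinearMap (toLin' (lowerUni u)⁻¹) (toLin' (lowerUni u))
    (by rw [← toLin'_mul, nonsing_inv_mul _ (isUnit_det_lowerUni u), toLin'_one])
    (by rw [← toLin'_mul, mul_nonsing_inv _ (isUnit_det_lowerUni u),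
      toLin'_one])).toContinuousLinearEquiv

/-- The isomorphism `E p ≅ ⨁_r K^{-(n-1)/2+r}` at the fibres over the base point `p` of
`x ∈ X₀`. The fibres of both bundles at `p` are `ℂⁿ`, read in the trivialization with index
`indexAt p`; in these coordinates the map is the inverse of the lower unipotent frame of `x`.
By `linearMapAt_splittingFiber` the same formula holds in every other trivialization. -/
noncomputable def splittingFiber (n : ℕ) (x : S.bigCell n) :
    ((S.bigCellProj n : S.bigCell n → C) *ᵖ (S.jetE n).Fiber) x ≃L[ℂ]
      ((S.bigCellProj n : S.bigCell n → C) *ᵖ (S.gradedE n).Fiber) x :=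
  lowerUniEquiv (S.lowerCoord (S.indexAt x.1.base) x.1)

/-- The inverse of the isomorphism is given by the lower unipotent frame of `x` in every
trivialization around `p`, not only in the preferred one used to define it. -/
theorem linearMapAt_splittingFiber_symm {n : ℕ} (x : S.bigCell n) {i : ι}
    (hi : S.bigCellProj n x ∈ S.dom i) (v : (S.gradedE n).Fiber (S.bigCellProj n x)) :
    ((S.jetE n).localTriv i).linearMapAt ℂ (S.bigCellProj n x) ((S.splittingFiber n x).symm v) =
      lowerUni (S.lowerCoord i x.1) *ᵥ
        ((S.gradedE n).localTriv i).linearMapAt ℂ (S.bigCellProj n x) v := by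
  refine (S.linearMapAt_localTriv hi _).trans
    (Eq.trans ?_ (congrArg _ (S.linearMapAt_gradedE hi v)).symm)
  refine (mulVec_mulVec (v : Fin n → ℂ) _ _).trans ?_
  exact (congrArg (· *ᵥ (v : Fin n → ℂ)) (S.jetMatrix_mul_lowerUni x.2 hi)).trans
    (mulVec_mulVec (v : Fin n → ℂ) _ _).symm

theorem linearMapAt_splittingFiber {n : ℕ} (x : S.bigCell n) {i : ι}
    (hi : S.bigCellProj n x ∈ S.dom i) (v : (S.jetE n).Fiber (S.bigCellProj n x)) :
    ((S.gradedE n).localTriv i).linearMapAt ℂ (S.bigCellProj n x) (S.splittingFiber n x v) =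
      (lowerUni (S.lowerCoord i x.1))⁻¹ *ᵥ
        ((S.jetE n).localTriv i).linearMapAt ℂ (S.bigCellProj n x) v := by
  have h := (congrArg (((S.jetE n).localTriv i).linearMapAt ℂ (S.bigCellProj n x))
    ((S.splittingFiber n x).symm_apply_apply v)).symm.trans
      (S.linearMapAt_splittingFiber_symm x hi (S.splittingFiber n x v))
  rw [h, mulVec_mulVec, nonsing_inv_mul _ (isUnit_det_lowerUni _), one_mulVec]

theorem contMDiffAt_lowerCoord_bigCell {n : ℕ} (x₀ : S.bigCell n) :
    ContMDiffAt 𝓘(ℂ, ℂ × (LowerIdx n → ℂ)) 𝓘(ℂ, LowerIdx n → ℂ) ω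
      (fun x : S.bigCell n => S.lowerCoord (S.indexAt x₀.1.base) x.1) x₀ :=
  (S.contMDiffAt_lowerCoord x₀.2).comp x₀ contMDiff_subtype_val.contMDiffAt

theorem contMDiffAt_lowerUni {n : ℕ} (x₀ : S.bigCell n) (r c : Fin n) :
    ContMDiffAt 𝓘(ℂ, ℂ × (LowerIdx n → ℂ)) 𝓘(ℂ) ω
      (fun x : S.bigCell n => lowerUni (S.lowerCoord (S.indexAt x₀.1.base) x.1) r c) x₀ := by
  have h : ContDiffAt ℂ ω (fun u : LowerIdx n → ℂ => lowerUni u r c)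
      (S.lowerCoord (S.indexAt x₀.1.base) x₀.1) :=
    (contDiffAt_lowerUni (0, _) r c).comp _ (contDiffAt_const.prodMk contDiffAt_id)
  exact ContMDiffAt.comp (g := fun u : LowerIdx n → ℂ => lowerUni u r c) x₀
    (contMDiffAt_iff_contDiffAt.2 h) (S.contMDiffAt_lowerCoord_bigCell x₀)

theorem contMDiffAt_lowerUni_inv {n : ℕ} (x₀ : S.bigCell n) (r c : Fin n) :
    ContMDiffAt 𝓘(ℂ, ℂ × (LowerIdx n → ℂ)) 𝓘(ℂ) ω
      (fun x : S.bigCell n => (lowerUni (S.lowerCoord (S.indexAt x₀.1.base) x.1))⁻¹ r c) x₀ := by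
  have h : ContDiffAt ℂ ω (fun u : LowerIdx n → ℂ => (lowerUni u)⁻¹ r c)
      (S.lowerCoord (S.indexAt x₀.1.base) x₀.1) :=
    contDiffAt_inv_entry (fun r c => (contDiffAt_lowerUni (0, _) r c).comp _
      (contDiffAt_const.prodMk contDiffAt_id)) (isUnit_det_lowerUni _).ne_zero r c
  exact ContMDiffAt.comp (g := fun u : LowerIdx n → ℂ => (lowerUni u)⁻¹ r c) x₀
    (contMDiffAt_iff_contDiffAt.2 h) (S.contMDiffAt_lowerCoord_bigCell x₀)


end SpinStructure

/-- A fibrewise map between the pullbacks of two bundles is holomorphic if it is given by a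
holomorphic matrix in local trivializations. -/
theorem contMDiff_pullback_of_matrix {n : ℕ} {B H X C : Type*} [NormedAddCommGroup B]
    [NormedSpace ℂ B] [TopologicalSpace H] {I : ModelWithCorners ℂ B H} [TopologicalSpace X]
    [ChartedSpace H X] [TopologicalSpace C] [ChartedSpace ℂ C] (f : C^ω⟮I, X; 𝓘(ℂ), C⟯)
    {E₁ E₂ : C → Type*} [∀ p, AddCommMonoid (E₁ p)] [∀ p, Module ℂ (E₁ p)]
    [TopologicalSpace (TotalSpace (Fin n → ℂ) E₁)] [∀ p, TopologicalSpace (E₁ p)]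
    [FiberBundle (Fin n → ℂ) E₁] [VectorBundle ℂ (Fin n → ℂ) E₁]
    [ContMDiffVectorBundle ω (Fin n → ℂ) E₁ 𝓘(ℂ)]
    [∀ p, AddCommMonoid (E₂ p)] [∀ p, Module ℂ (E₂ p)]
    [TopologicalSpace (TotalSpace (Fin n → ℂ) E₂)] [∀ p, TopologicalSpace (E₂ p)]
    [FiberBundle (Fin n → ℂ) E₂] [VectorBundle ℂ (Fin n → ℂ) E₂]
    [ContMDiffVectorBundle ω (Fin n → ℂ) E₂ 𝓘(ℂ)]
    (φ : ∀ x : X, E₁ (f x) → E₂ (f x)) (A : X → X → Matrix (Fin n) (Fin n) ℂ)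
    (hA : ∀ x₀ r c, ContMDiffAt I 𝓘(ℂ) ω (fun x => A x₀ x r c) x₀)
    (hφ : ∀ x₀ x, f x ∈ (trivializationAt (Fin n → ℂ) E₁ (f x₀)).baseSet → ∀ v : E₁ (f x),
      (trivializationAt (Fin n → ℂ) E₂ (f x₀) ⟨f x, φ x v⟩).2 =
        A x₀ x *ᵥ (trivializationAt (Fin n → ℂ) E₁ (f x₀) ⟨f x, v⟩).2) :
    ContMDiff (I.prod 𝓘(ℂ, Fin n → ℂ)) (I.prod 𝓘(ℂ, Fin n → ℂ)) ω
      fun v : TotalSpace (Fin n → ℂ) ((f : X → C) *ᵖ E₁) =>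
        (⟨v.1, φ v.1 v.2⟩ : TotalSpace (Fin n → ℂ) ((f : X → C) *ᵖ E₂)) := by
  intro v₀
  rw [contMDiffAt_totalSpace]
  have hproj := contMDiffAt_proj (IB := I) (n := ω) ((f : X → C) *ᵖ E₁) (p := v₀)
  refine ⟨hproj, ?_⟩
  -- The fibre coordinate of a point of the total space is a holomorphic function.
  have hid := (contMDiffAt_totalSpace.1 (contMDiffAt_id (x := v₀) (n := ω)
    (I := I.prod 𝓘(ℂ, Fin n → ℂ)))).2
  have hmul := ContMDiffAt.matrix_mulVec
    (A := fun v : TotalSpace (Fin n → ℂ) ((f : X → C) *ᵖ E₁) => A v₀.1 v.1)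
    (fun r c => (hA v₀.1 r c).comp v₀ hproj) hid
  refine hmul.congr_of_eventuallyEq ?_
  have hopen := (trivializationAt (Fin n → ℂ) E₁ (f v₀.1)).open_baseSet.preimage
    f.contMDiff.continuous
  filter_upwards [hproj.continuousAt.preimage_mem_nhds
    (hopen.mem_nhds (mem_baseSet_trivializationAt (Fin n → ℂ) E₁ (f v₀.1)))] with v hv
  exact hφ v₀.1 v.1 hv v.2

namespace SpinStructure

variable {C ι : Type*} [TopologicalSpace C] [ChartedSpace ℂ C] [IsManifold 𝓘(ℂ) ω C]
  (S : SpinStructure C ι)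

/-- The isomorphism `π^*E ≅ π^*(⨁_r K^{-(n-1)/2+r})` over the big cell. -/
noncomputable def splitting (n : ℕ) : HolomorphicBundleIso 𝓘(ℂ, ℂ × (LowerIdx n → ℂ))
    (Fin n → ℂ) ((S.bigCellProj n : S.bigCell n → C) *ᵖ (S.jetE n).Fiber)
    (Fin n → ℂ) ((S.bigCellProj n : S.bigCell n → C) *ᵖ (S.gradedE n).Fiber) where
  toEquiv := S.splittingFiber n
  holomorphic := by
    refine contMDiff_pullback_of_matrix (S.bigCellProj n) (E₁ := (S.jetE n).Fiber)
      (E₂ := (S.gradedE n).Fiber) (fun x => S.splittingFiber n x)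
      (fun x₀ x => (lowerUni (S.lowerCoord (S.indexAt x₀.1.base) x.1))⁻¹)
      S.contMDiffAt_lowerUni_inv fun x₀ x hx v => ?_
    have hi : S.bigCellProj n x ∈ S.dom (S.indexAt x₀.1.base) := hx
    have := S.linearMapAt_splittingFiber x hi v
    rw [Trivialization.coe_linearMapAt_of_mem ((S.jetE n).localTriv _) hi,
      Trivialization.coe_linearMapAt_of_mem ((S.gradedE n).localTriv _) hi] at this
    exact this
  holomorphic_symm := by
    refine contMDiff_pullback_of_matrix (S.bigCellProj n) (E₁ := (S.gradedE n).Fiber)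
      (E₂ := (S.jetE n).Fiber) (fun x => (S.splittingFiber n x).symm)
      (fun x₀ x => lowerUni (S.lowerCoord (S.indexAt x₀.1.base) x.1))
      S.contMDiffAt_lowerUni fun x₀ x hx v => ?_
    have hi : S.bigCellProj n x ∈ S.dom (S.indexAt x₀.1.base) := hx
    have := S.linearMapAt_splittingFiber_symm x hi v
    rw [Trivialization.coe_linearMapAt_of_mem ((S.jetE n).localTriv _) hi,
      Trivialization.coe_linearMapAt_of_mem ((S.gradedE n).localTriv _) hi] at this
    exact this

theorem mem_flag_iff_splittingFiber_mem {n : ℕ} (x : S.bigCell n) (j : Fin (n + 1))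
    (v : (S.jetE n).Fiber (S.bigCellProj n x)) :
    v ∈ x.1.flag.space j ↔ S.splittingFiber n x v ∈ S.partialSum n j (S.bigCellProj n x) := by
  set u := S.lowerCoord (S.indexAt x.1.base) x.1 with hu
  refine (S.mem_flag_iff x.2 j v).trans (mem_colSpan.trans ⟨?_, fun h => ?_⟩)
  · rintro ⟨w, hw, e⟩
    have : (lowerUni u)⁻¹ *ᵥ (v : Fin n → ℂ) = w := by
      refine (congrArg _ e.symm).trans ?_
      rw [mulVec_mulVec, nonsing_inv_mul _ (isUnit_det_lowerUni u), one_mulVec]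
    exact (congrArg (· ∈ stdSub n j) this).mpr hw
  · exact ⟨_, h, (S.splittingFiber n x).symm_apply_apply v⟩

/-- A unipotent matrix induces the identity on the graded pieces of the filtration. -/
theorem component_splittingFiber {n : ℕ} (x : S.bigCell n) (k : Fin n)
    (v : S.filtration n (n - k) (S.bigCellProj n x)) :
    (∀ r < k, S.component n r (S.bigCellProj n x) (S.splittingFiber n x v.1) = 0) ∧
      S.component n k (S.bigCellProj n x) (S.splittingFiber n x v.1) =
        S.symbol n k (S.bigCellProj n x) v := by
  have hv := (S.mem_filtration k).1 v.2
  have hw : lowerUni (S.lowerCoord (S.indexAt x.1.base) x.1) *ᵥ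
      (S.splittingFiber n x v.1 : Fin n → ℂ) = v.1 := (S.splittingFiber n x).symm_apply_apply v.1
  have h0 := eq_zero_of_lowerUni_mulVec _ fun r hr => (congrFun hw r).trans (hv r hr)
  exact ⟨h0, (lowerUni_mulVec_of_forall_lt _ h0).symm.trans (congrFun hw k)⟩

end SpinStructure

/-! ### The isomorphism adapted to the tautological flag -/

theorem mainTheorem2 {C ι : Type*} [TopologicalSpace C] [ChartedSpace ℂ C]
    [IsManifold 𝓘(ℂ) ω C] (S : SpinStructure C ι) (n : ℕ) (hn : 1 ≤ n) :
    (∀ (k : Fin n) (p : C),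
      Function.Surjective (S.symbol n k p) ∧
      LinearMap.ker (S.symbol n k p) =
        (S.filtration n (n - k - 1) p).comap (S.filtration n (n - k) p).subtype ∧
      ∀ i, p ∈ S.dom i → ∀ v : S.filtration n (n - k) p,
        ((S.jetE n).localTriv i).linearMapAt ℂ p v k =
          ((S.canonicalPow (SpinStructure.gradedExp n k)).localTriv i).linearMapAt ℂ p (S.symbol n k p v)) ∧
    ∃ Φ : HolomorphicBundleIso 𝓘(ℂ, ℂ × (LowerIdx n → ℂ))
        (Fin n → ℂ) ((S.bigCellProj n : S.bigCell n → C) *ᵖ (S.jetE n).Fiber)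
        (Fin n → ℂ) ((S.bigCellProj n : S.bigCell n → C) *ᵖ (S.gradedE n).Fiber),
      (∀ (x : S.bigCell n) (j : Fin (n + 1)) (v : (S.jetE n).Fiber (S.bigCellProj n x)),
        v ∈ x.1.flag.space j ↔ Φ.toEquiv x v ∈ S.partialSum n j (S.bigCellProj n x)) ∧
      (∀ (x : S.bigCell n) (k : Fin n) (v : S.filtration n (n - k) (S.bigCellProj n x)),
        (∀ r < k, S.component n r (S.bigCellProj n x) (Φ.toEquiv x v.1) = 0) ∧
        S.component n k (S.bigCellProj n x) (Φ.toEquiv x v.1) = S.symbol n k (S.bigCellProj n x) v) ∧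
      (∀ (x : S.bigCell n) (i : ι), S.bigCellProj n x ∈ S.dom i → ∃ u : LowerIdx n → ℂ,
        (∀ j : Fin (n + 1), FlagBundle.trivFlag ((S.jetE n).localTriv i) x.1 j =
          colSpan (lowerUni u) j) ∧
        ∀ v : (S.gradedE n).Fiber (S.bigCellProj n x),
          ((S.jetE n).localTriv i).linearMapAt ℂ (S.bigCellProj n x) ((Φ.toEquiv x).symm v) =
            lowerUni u *ᵥ ((S.gradedE n).localTriv i).linearMapAt ℂ (S.bigCellProj n x) v) := by
  refine ⟨fun k p => ⟨S.symbol_surjective n k p, S.ker_symbol n k p, fun i hi v =>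
    S.linearMapAt_symbol k hi v⟩, S.splitting n,
    fun x j v => S.mem_flag_iff_splittingFiber_mem x j v,
    fun x k v => S.component_splittingFiber x k v, fun x i hi => ⟨S.lowerCoord i x.1,
      fun j => S.trivFlag_eq_colSpan_lowerCoord x.2 hi j,
      fun v => S.linearMapAt_splittingFiber_symm x hi v⟩⟩
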